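/- Let $n\ge 1$ and let $\omega_n$ be the volume of the unit ball of $\mathbb R^n$. Let $M$ be a connected smooth $n$-manifold without boundary (Hausdorff, second countable) and let $F:TM\to[0,\infty)$ be a Finsler metric: $F$ is $C^\infty$ off the zero section, $F(cv)=cF(v)$ for $c\ge 0$, and the Hessian of $\frac12F^2|_{T_xM}$ is positive definite at every $v\in T_xM\setminus\{0\}$. Assume that the reversibility constant $\kappa_F=\sup_{x\in M}\sup_{v\in T_xM\setminus\{0\}}F(v)/F(-v)$ is finite. Let $B_xM=\{v\in T_xM: F(v)<1\}$, let $\mathfrak m_F$ be the Busemann–Hausdorff measure, $d\mathfrak m_F=\frac{\omega_n}{\mathrm{Vol}(B_xM)}dx^1\cdots dx^n$ in local coordinates, and let $g_F$ be the Binet–Legendre metric, that is, the metric dual to the scalar product $$g_F^*(\alpha,\beta)=\frac{n+2}{\lambda(B_xM)}\int_{B_xM}\alpha(v)\beta(v)\,d\lambda(v)\qquad(\alpha,\beta\in T_x^*M),$$ where $\lambda$ is any Lebesgue measure on $T_xM$. Let $dV_{g_F}$ be the Riemannian volume of $g_F$. For $p>1$, let $\lambda_{1,p}(M,F)$ be the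 infimum of $\int_M F(\nabla f)^p\,d\mathfrak m_F\big/\int_M|f|^p\,d\mathfrak m_F$ over all $f\in W^{1,p}(M)\setminus\{0\}$ with $\int_M|f|^{p-2}f\,d\mathfrak m_F=0$. Here $\nabla f(x)$ is the Legendre transform of $df_x$, i.e. the unique maximizer of $v\mapsto df_x(v)-\frac12F(v)^2$ on $T_xM$, and $W^{1,p}(M)$ is the completion, for the Sobolev norm, of the space of smooth functions $u$ with $\int|u|^p\,d\mathfrak m_F<\infty$ and $\int F(\nabla u)^p\,d\mathfrak m_F<\infty$ (the energy being extended by continuity). Let $\lambda_{1,p}(M,g_F)$ be defined in the same way from the norm $\sqrt{g_F}$ and the measure $dV_{g_F}$. Then the following holds. 1. There is a constant $k>0$ depending only on $n$ such that, for every such $(M,F)$, $$\omega_nk^{-n}\,dV_{g_F}\le d\mathfrak m_F\le\omega_nk^n\,dV_{g_F}.\tag{$*$}$$ 2. If $\mathfrak m_F(M)<\infty$ (in particular if $M$ is compact), then for every $k>0$ satisfying $(*)$ on $(M,F)$ and every $p>1$, $$\frac{1}{(\kappa_F\sqrt{2n})^{p(n+1)}\omega_nk^n}\,\lambda_{1,p}(M,g_F)\le\lambda_{1,p}(M,F)\le(\kappa_F\sqrt{2n})^{p(n+1)}\omega_nk^n\,\lambda_{1,p}(M,g_F),$$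 and hence, whenever $\lambda_{1,p}(M,g_F)>0$ (so that the quotient is defined), $$\frac{1}{(\kappa_F\sqrt{2n})^{p(n+1)}\omega_nk^n}\le\frac{\lambda_{1,p}(M,F)}{\lambda_{1,p}(M,g_F)}\le(\kappa_F\sqrt{2n})^{p(n+1)}\omega_nk^n.$$ -/

import Mathlib

open Set Filter Topology MeasureTheory
open scoped Manifold ContDiff NNReal ENNReal

noncomputable section

/-- The model space `ℝⁿ` with its Euclidean norm and Lebesgue measure. -/
abbrev EucSp (n : ℕ) : Type := EuclideanSpace ℝ (Fin n)

/-- `ω_n`, the volume of the unit ball of `ℝⁿ`. -/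
def unitBallVol (n : ℕ) : ℝ := volume.real (Metric.ball (0 : EucSp n) 1)

/-- A Finsler metric on a smooth `n`-manifold `M`: a nonnegative function on `TM`, smooth off the
zero section, positively `1`-homogeneous on each tangent space, and such that for every
`v ∈ T_xM \ {0}` the Hessian at `v` of `F² / 2` restricted to `T_xM` is positive definite. -/
structure FinslerMetric (n : ℕ) (M : Type*) [TopologicalSpace M]
    [ChartedSpace (EucSp n) M] [IsManifold (𝓡 n) ∞ M] where
  toFun : (x : M) → TangentSpace (𝓡 n) x → ℝ
  nonneg : ∀ (x : M) (v : TangentSpace (𝓡 n) x), 0 ≤ toFun x v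
  smooth : ContMDiffOn (𝓡 n).tangent 𝓘(ℝ, ℝ) ∞
    (fun v : TangentBundle (𝓡 n) M => toFun v.1 v.2) {v | v.2 ≠ 0}
  homogeneous : ∀ (x : M) (c : ℝ) (v : TangentSpace (𝓡 n) x), 0 ≤ c →
    toFun x (c • v) = c * toFun x v
  strongly_convex : ∀ (x : M) (v w : EucSp n), v ≠ 0 → w ≠ 0 →
    0 < iteratedFDeriv ℝ 2 (fun u : EucSp n => toFun x u ^ 2 / 2) v ![w, w]

section Tangent

variable {n : ℕ} {M : Type*} [TopologicalSpace M] [ChartedSpace (EucSp n) M]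

/-- The Legendre transform of `α ∈ T_x^*M`: the maximizer on `T_xM` of `v ↦ α(v) - N(v)² / 2`.
(It exists and is unique if `N` is a Finsler metric or the norm of a Riemannian metric.) -/
def legendre (N : (x : M) → TangentSpace (𝓡 n) x → ℝ) (x : M)
    (α : TangentSpace (𝓡 n) x →L[ℝ] ℝ) : TangentSpace (𝓡 n) x :=
  Classical.epsilon fun v => ∀ w : TangentSpace (𝓡 n) x,
    α w - N x w ^ 2 / 2 ≤ α v - N x v ^ 2 / 2

/-- The gradient at `x` of a differentiable function `f`: the Legendre transform of `df_x`. -/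
def gradientVec (N : (x : M) → TangentSpace (𝓡 n) x → ℝ) (f : M → ℝ) (x : M) :
    TangentSpace (𝓡 n) x :=
  legendre N x (mfderiv (𝓡 n) 𝓘(ℝ, ℝ) f x)

/-- The vector of `T_xM`, `x = e⁻¹(y)`, whose coordinates in the chart `e` are `a`, that is,
`∑ i, aᵢ ∂/∂xᵢ`. -/
def chartVec (e : OpenPartialHomeomorph M (EucSp n)) (y a : EucSp n) :
    TangentSpace (𝓡 n) (e.symm y) :=
  mfderiv (𝓡 n) (𝓡 n) e.symm y a

/-- The measure on `M` which in every smooth chart `e` has the density `ρ e` with respect to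
`dx¹ … dxⁿ`, where the family `ρ` transforms as a density under changes of charts. Then the measures
that the charts `e` define on their domains agree on the overlaps, and the least measure above
all of them is the measure obtained by gluing. -/
def densityMeasure [MeasurableSpace M]
    (ρ : OpenPartialHomeomorph M (EucSp n) → EucSp n → ℝ≥0∞) : Measure M :=
  ⨆ e ∈ IsManifold.maximalAtlas (𝓡 n) ∞ M,
    Measure.map e.symm ((volume.restrict e.target).withDensity (ρ e))

/-- The Riemannian volume `√(det (g(∂/∂xᵢ, ∂/∂xⱼ))) dx¹ … dxⁿ` of a field of scalar products. -/
def riemannianVol [MeasurableSpace M]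
    (g : (x : M) → TangentSpace (𝓡 n) x → TangentSpace (𝓡 n) x → ℝ) : Measure M :=
  densityMeasure fun e y => ENNReal.ofReal (Real.sqrt (Matrix.det (Matrix.of fun i j : Fin n =>
    g (e.symm y) (chartVec e y (EuclideanSpace.single i 1))
      (chartVec e y (EuclideanSpace.single j 1)))))

/-- The norm `v ↦ √(g(v, v))` of a field of scalar products. -/
def metricNorm (g : (x : M) → TangentSpace (𝓡 n) x → TangentSpace (𝓡 n) x → ℝ) :
    (x : M) → TangentSpace (𝓡 n) x → ℝ :=
  fun x v => Real.sqrt (g x v v)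

variable [MeasurableSpace M]

/-- `∫_M N(∇u)^p dm` for a smooth function `u`. -/
def smoothEnergy (N : (x : M) → TangentSpace (𝓡 n) x → ℝ) (m : Measure M) (p : ℝ)
    (u : M → ℝ) : ℝ≥0∞ :=
  ∫⁻ x, ENNReal.ofReal (N x (gradientVec N u x) ^ p) ∂m

/-- `f ∈ W^{1,p}(M)` and `∫_M |∇f|^p dm = E`. Here `W^{1,p}(M)` is the completion of the space of
smooth functions `u` on `M` with `∫ |u|^p dm < ∞` and `∫ N(∇u)^p dm < ∞`: `f` is the `L^p`-limit of
a sequence of such functions that is Cauchy for the Sobolev norm, and the energy of `f` is the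
limit of the energies. -/
def HasSobolevEnergy (N : (x : M) → TangentSpace (𝓡 n) x → ℝ) (m : Measure M) (p : ℝ)
    (f : M → ℝ) (E : ℝ≥0) : Prop :=
  MemLp f (ENNReal.ofReal p) m ∧
  ∃ u : ℕ → M → ℝ,
    (∀ j, ContMDiff (𝓡 n) 𝓘(ℝ, ℝ) ∞ (u j)) ∧
    (∀ j, MemLp (u j) (ENNReal.ofReal p) m) ∧
    (∀ j, smoothEnergy N m p (u j) < ⊤) ∧
    Tendsto (fun j => eLpNorm (u j - f) (ENNReal.ofReal p) m) atTop (𝓝 0) ∧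
    (∀ ε : ℝ≥0∞, 0 < ε → ∃ J : ℕ, ∀ i j, J ≤ i → J ≤ j →
      smoothEnergy N m p (u i - u j) ≤ ε) ∧
    Tendsto (fun j => smoothEnergy N m p (u j)) atTop (𝓝 (E : ℝ≥0∞))

/-- The first (closed) eigenvalue of the `p`-Laplacian of `(M, N, m)`: the infimum of
`∫ |∇f|^p dm / ∫ |f|^p dm` over all `f ∈ W^{1,p}(M) \ {0}` with `∫ |f|^{p-2} f dm = 0`. -/
def firstEigenvalue (N : (x : M) → TangentSpace (𝓡 n) x → ℝ) (m : Measure M) (p : ℝ) : ℝ :=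
  sInf {r : ℝ | ∃ (f : M → ℝ) (E : ℝ≥0), HasSobolevEnergy N m p f E ∧
    ¬ f =ᵐ[m] 0 ∧
    Integrable (fun x => |f x| ^ (p - 2) * f x) m ∧
    ∫ x, |f x| ^ (p - 2) * f x ∂m = 0 ∧
    r = (E : ℝ) / ∫ x, |f x| ^ p ∂m}

end Tangent

namespace FinslerMetric

variable {n : ℕ} {M : Type*} [TopologicalSpace M] [ChartedSpace (EucSp n) M]
  [IsManifold (𝓡 n) ∞ M]

/-- The reversibility constant `κ_F = sup F(v) / F(-v) ∈ [1, ∞]`, the supremum being over all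
nonzero tangent vectors `v`. -/
def reversibility (F : FinslerMetric n M) : ℝ≥0∞ :=
  ⨆ (x : M) (v : TangentSpace (𝓡 n) x) (_ : v ≠ 0),
    ENNReal.ofReal (F.toFun x v / F.toFun x (-v))

/-- The open unit ball `B_xM = {v ∈ T_xM : F(x, v) < 1}`. -/
def unitBall (F : FinslerMetric n M) (x : M) : Set (EucSp n) :=
  {v : EucSp n | F.toFun x v < 1}

/-- The Busemann-Hausdorff measure `ω_n / Vol(B_xM) dx¹ … dxⁿ`, the volume of `B_xM` being taken in
the coordinates of `T_xM` that the chart defines. -/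
def busemannHausdorff [MeasurableSpace M] (F : FinslerMetric n M) : Measure M :=
  densityMeasure fun e y => ENNReal.ofReal
    (unitBallVol n / volume.real {a : EucSp n | F.toFun (e.symm y) (chartVec e y a) < 1})

/-- The scalar product
`g_F^*(α, β) = (n + 2) / λ(B_xM) * ∫_{B_xM} α(v) β(v) dλ(v)` on `T_x^*M`. It does not depend on the
Lebesgue measure `λ` on `T_xM`. -/
def binetDual (F : FinslerMetric n M) (x : M) (α β : EucSp n →L[ℝ] ℝ) : ℝ :=
  ((n : ℝ) + 2) / volume.real (F.unitBall x) * ∫ v in F.unitBall x, α v * β v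

/-- The Gram matrix of `g_F^*` in the basis of `T_x^*M` of the coordinate functions of `T_xM`. -/
def binetDualMatrix (F : FinslerMetric n M) (x : M) : Matrix (Fin n) (Fin n) ℝ :=
  Matrix.of fun i j => F.binetDual x (EuclideanSpace.proj i) (EuclideanSpace.proj j)

/-- The Binet-Legendre metric `g_F`: the scalar product on `T_xM` dual to `g_F^*`, whose Gram matrix
in the dual basis is the inverse of that of `g_F^*`. -/
def binetLegendre (F : FinslerMetric n M) (x : M) (v w : EucSp n) : ℝ :=
  ∑ i, ∑ j, (F.binetDualMatrix x)⁻¹ i j * v i * w j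

/-- `λ_{1,p}(M, F)`, with respect to the Busemann-Hausdorff measure. -/
def eigenvalueF [MeasurableSpace M] (F : FinslerMetric n M) (p : ℝ) : ℝ :=
  firstEigenvalue F.toFun F.busemannHausdorff p

/-- `λ_{1,p}(M, g_F)`, with respect to the Riemannian volume of `g_F`. -/
def eigenvalueBL [MeasurableSpace M] (F : FinslerMetric n M) (p : ℝ) : ℝ :=
  firstEigenvalue (metricNorm F.binetLegendre) (riemannianVol F.binetLegendre) p

/-- `ω_n k⁻ⁿ dV_{g_F} ≤ dm_F ≤ ω_n kⁿ dV_{g_F}`, where `m_F` is the Busemann-Hausdorff measure. -/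
def VolumeComparison [MeasurableSpace M] (F : FinslerMetric n M) (k : ℝ) : Prop :=
  ENNReal.ofReal (unitBallVol n * (k ^ n)⁻¹) • riemannianVol F.binetLegendre
      ≤ F.busemannHausdorff ∧
    F.busemannHausdorff ≤ ENNReal.ofReal (unitBallVol n * k ^ n) • riemannianVol F.binetLegendre

/-- The constant `(κ_F √(2n))^{p(n+1)} ω_n kⁿ`. -/
def comparisonConst (F : FinslerMetric n M) (p k : ℝ) : ℝ :=
  (F.reversibility.toReal * Real.sqrt (2 * (n : ℝ))) ^ (p * ((n : ℝ) + 1)) * unitBallVol n * k ^ n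

end FinslerMetric

end

/-!
Two facts about one tangent space carry the comparison. Let `B = {F < 1}` be the unit ball of `F`
in `T_xM`, `G* = (n + 2) / vol(B) * ∫_B vᵢ vⱼ` the Gram matrix of the dual of `g_F`, and `κ` the
reversibility constant.

*Volumes.* In coordinates `m_F` has the density `ω_n / vol(B)` and `dV_{g_F}` the density
`√(det (G*)⁻¹)`. With `Q = ⟨(G*)⁻¹ v, v⟩`, the definition of `G*` says that
`∫_B (1 - Q) = 2 / (n + 2) * vol(B)`, and by homogeneity the same formula holds for the ellipsoid
`{Q < 1}`. Since the ellipsoid is the set where `1 - Q` is positive, it has at least the volume of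
`B`, so that `dV_{g_F} ≤ m_F` (`IsMinkowskiNorm.volume_mul_sqrt_det_inv_momentMatrix_le`). In the
other direction, an Auerbach basis of `B` bounds `det G*` by a multiple of `vol(B)²` which depends
on `n` only (`IsMinkowskiNorm.det_momentMatrix_le`). The measures are suprema of measures given by
densities in charts, so that inequalities between densities suffice; no gluing is involved.

*Dual norms.* `F(∇f)` is the dual norm of `df` for `F`, and `|∇f|_{g_F}` the one for `g_F`; the
square of the latter is a normalized second moment of `df` on `B`. It is at most `(n + 2) κ²` times
`F(∇f)²` by the trivial pointwise bound, and at least `F(∇f)² / (4 n κ²)`, because `B` contains its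
images under the contractions towards the points of its closure
(`IsMinkowskiNorm.moment_le_of_maximizer`, `IsMinkowskiNorm.sq_le_moment_of_maximizer`). Both
factors are at most `(κ √(2n))^{2(n+1)}`.

*Eigenvalues.* Suppose `μ ≤ A ν` and `ν ≤ B μ` for finite measures, and one dual norm is at most `C`
times the other. A test function for `μ` becomes one for `ν` after subtraction of a constant, which
exists by the intermediate value theorem. As a function centred for `μ` is `L^p(μ)`-closest to `0`
among its translates, the Rayleigh quotient grows at most by the factor `C^p A B`
(`firstEigenvalue_le`). For `m_F` and `dV_{g_F}` one of `A`, `B` is `1` and the other is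
`ω_n kⁿ`, which is why this constant occurs only once in the result.
-/

/-! ### Minkowski norms on the tangent spaces -/

/-- A (not necessarily reversible) Minkowski norm on a real normed space: a continuous, positive
definite, positively homogeneous and subadditive function. This is what convex geometry uses of the
restriction of a Finsler metric to a tangent space; neither smoothness nor strict convexity is
recorded. -/
structure IsMinkowskiNorm {E : Type*} [NormedAddCommGroup E] [NormedSpace ℝ E] (N : E → ℝ) :
    Prop where
  nonneg : ∀ v, 0 ≤ N v
  map_smul : ∀ (c : ℝ) (v : E), 0 ≤ c → N (c • v) = c * N v
  pos : ∀ v, v ≠ 0 → 0 < N v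
  continuous : Continuous N
  add_le : ∀ v w, N (v + w) ≤ N v + N w

section Hessian

variable {E : Type*} [NormedAddCommGroup E] [NormedSpace ℝ E]

theorem hasDerivAt_comp_line {φ : E → ℝ} {a w : E} {t : ℝ}
    (h : ContDiffAt ℝ 2 φ (a + t • w)) :
    HasDerivAt (fun s : ℝ => φ (a + s • w)) (fderiv ℝ φ (a + t • w) w) t := by
  have h1 : HasDerivAt (fun s : ℝ => a + s • w) w t := by
    simpa using ((hasDerivAt_id t).smul_const w).const_add a
  exact (h.differentiableAt (by norm_num)).hasFDerivAt.comp_hasDerivAt t h1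

theorem hasDerivAt_fderiv_comp_line {φ : E → ℝ} {a w : E} {t : ℝ}
    (h : ContDiffAt ℝ 2 φ (a + t • w)) :
    HasDerivAt (fun s : ℝ => fderiv ℝ φ (a + s • w) w)
      (iteratedFDeriv ℝ 2 φ (a + t • w) ![w, w]) t := by
  have h1 : HasDerivAt (fun s : ℝ => a + s • w) w t := by
    simpa using ((hasDerivAt_id t).smul_const w).const_add a
  have h2 : DifferentiableAt ℝ (fderiv ℝ φ) (a + t • w) :=
    (h.fderiv_right (m := 1) (by norm_num)).differentiableAt (by norm_num)
  have h3 : HasDerivAt (fun s : ℝ => fderiv ℝ φ (a + s • w))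
      (fderiv ℝ (fderiv ℝ φ) (a + t • w) w) t := h2.hasFDerivAt.comp_hasDerivAt t h1
  rw [iteratedFDeriv_two_apply]
  have h4 := (ContinuousLinearMap.apply ℝ ℝ w).hasFDerivAt.comp_hasDerivAt t h3
  exact h4

variable {N : E → ℝ}

theorem contDiffAt_half_sq (hsm : ContDiffOn ℝ 2 N {0}ᶜ) {v : E} (hv : v ≠ 0) :
    ContDiffAt ℝ 2 (fun u => N u ^ 2 / 2) v :=
  ((hsm.contDiffAt (isOpen_compl_singleton.mem_nhds hv)).pow 2).div_const 2

/-- On the ray through `v` the function `N² / 2` is a multiple of the square of the parameter; if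
`N v = 0`, it vanishes there, and so does its second derivative. -/
theorem pos_of_hessian_pos (nonneg : ∀ v, 0 ≤ N v)
    (homog : ∀ (c : ℝ) (v : E), 0 ≤ c → N (c • v) = c * N v)
    (hsm : ContDiffOn ℝ 2 N {0}ᶜ)
    (hess : ∀ v w : E, v ≠ 0 → w ≠ 0 →
      0 < iteratedFDeriv ℝ 2 (fun u : E => N u ^ 2 / 2) v ![w, w])
    {v : E} (hv : v ≠ 0) : 0 < N v := by
  refine (nonneg v).lt_of_ne' fun h0 => ?_
  have hmem : ∀ t : ℝ, -1 < t → v + t • v ≠ 0 := by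
    intro t ht h
    have : (1 + t) • v = 0 := by rw [add_smul, one_smul, h]
    rcases smul_eq_zero.1 this with h | h
    · linarith
    · exact hv h
  have hd : ∀ t : ℝ, -1 < t → fderiv ℝ (fun u => N u ^ 2 / 2) (v + t • v) v = 0 := by
    intro t ht
    have h1 := hasDerivAt_comp_line (contDiffAt_half_sq hsm (hmem t ht))
    refine h1.unique ((hasDerivAt_const t (0 : ℝ)).congr_of_eventuallyEq ?_)
    filter_upwards [lt_mem_nhds ht] with s hs
    have : v + s • v = (1 + s) • v := by rw [add_smul, one_smul]
    rw [this, homog _ _ (by linarith), h0]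
    simp
  have h2 := hasDerivAt_fderiv_comp_line (t := 0) (contDiffAt_half_sq hsm (hmem 0 (by norm_num)))
  have h3 : iteratedFDeriv ℝ 2 (fun u => N u ^ 2 / 2) (v + (0 : ℝ) • v) ![v, v] = 0 := by
    refine h2.unique ((hasDerivAt_const (0 : ℝ) (0 : ℝ)).congr_of_eventuallyEq ?_)
    filter_upwards [lt_mem_nhds (show (-1 : ℝ) < 0 by norm_num)] with s hs using hd s hs
  rw [zero_smul, add_zero] at h3
  exact (hess v v hv hv).ne' h3

theorem continuous_of_homogeneous [FiniteDimensional ℝ E] (nonneg : ∀ v, 0 ≤ N v)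
    (homog : ∀ (c : ℝ) (v : E), 0 ≤ c → N (c • v) = c * N v)
    (hc : ContinuousOn N {0}ᶜ) : Continuous N := by
  have h0 : N 0 = 0 := by simpa using homog 0 0 le_rfl
  obtain ⟨K, hK⟩ := (isCompact_sphere (0 : E) 1).exists_bound_of_continuousOn
    (hc.mono fun v hv => by
      simp only [mem_compl_iff, mem_singleton_iff]
      rintro rfl
      simp at hv)
  rw [continuous_iff_continuousAt]
  intro v
  by_cases hv : v = 0
  · subst hv
    have hb : ∀ v : E, N v ≤ K * ‖v‖ := by
      intro v
      by_cases hv : v = 0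
      · simp [hv, h0]
      have hn : 0 < ‖v‖ := norm_pos_iff.2 hv
      have h1 := hK (‖v‖⁻¹ • v) (by simp [norm_smul, hn.ne'])
      have h2 : N v = ‖v‖ * N (‖v‖⁻¹ • v) := by
        rw [← homog _ _ hn.le, smul_smul, mul_inv_cancel₀ hn.ne', one_smul]
      rw [h2, mul_comm]
      exact mul_le_mul_of_nonneg_right ((le_abs_self _).trans h1) hn.le
    rw [ContinuousAt, h0]
    refine squeeze_zero nonneg hb ?_
    have : Tendsto (fun v : E => K * ‖v‖) (𝓝 0) (𝓝 (K * ‖(0 : E)‖)) :=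
      (continuous_const.mul continuous_norm).tendsto _
    simpa using this
  · exact hc.continuousAt (isOpen_compl_singleton.mem_nhds hv)

/-- Segments that avoid the origin are handled by the Hessian; a segment through the origin consists
of nonnegative multiples of its end points. -/
theorem convex_ball_of_hessian_pos (nonneg : ∀ v, 0 ≤ N v)
    (homog : ∀ (c : ℝ) (v : E), 0 ≤ c → N (c • v) = c * N v)
    (hsm : ContDiffOn ℝ 2 N {0}ᶜ)
    (hess : ∀ v w : E, v ≠ 0 → w ≠ 0 →
      0 < iteratedFDeriv ℝ 2 (fun u : E => N u ^ 2 / 2) v ![w, w]) :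
    Convex ℝ {v | N v < 1} := by
  rw [convex_iff_forall_pos]
  intro x hx y hy a b ha hb hab
  simp only [mem_ofPred_eq] at hx hy ⊢
  have h0 : N 0 = 0 := by simpa using homog 0 0 le_rfl
  have hscale : ∀ (c : ℝ) (v : E), 0 ≤ c → c ≤ 1 → N v < 1 → N (c • v) < 1 := by
    intro c v hc hc1 hv
    rw [homog _ _ hc]
    nlinarith [nonneg v]
  by_cases hxy : y = x
  · subst hxy
    rwa [← add_smul, hab, one_smul]
  by_cases hz : ∃ t ∈ Icc (0 : ℝ) 1, x + t • (y - x) = 0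
  · obtain ⟨t, ⟨ht0, ht1⟩, ht⟩ := hz
    have ht' : (1 - t) • x = -(t • y) := by
      rw [← sub_eq_zero, ← ht]; module
    rcases eq_or_lt_of_le ht1 with rfl | ht1
    · have : y = 0 := by simpa using ht
      rw [this, smul_zero, add_zero]
      exact hscale a x ha.le (by linarith) hx
    have hx' : x = (-(t / (1 - t))) • y := by
      have h1 : (1 - t) ≠ 0 := by linarith
      rw [neg_smul, div_eq_inv_mul, mul_smul, ← smul_neg, ← ht', smul_smul, inv_mul_cancel₀ h1,
        one_smul]
    rcases le_or_gt 0 (b - a * (t / (1 - t))) with hs | hs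
    · have : a • x + b • y = (b - a * (t / (1 - t))) • y := by
        conv_lhs => rw [hx']
        module
      rw [this]
      refine hscale _ _ hs ?_ hy
      have : 0 ≤ a * (t / (1 - t)) := by
        have : 0 < 1 - t := by linarith
        positivity
      linarith
    · have ht0' : 0 < t := by
        rcases eq_or_lt_of_le ht0 with rfl | h
        · simp at hs; linarith
        · exact h
      have h1 : 0 < 1 - t := by linarith
      have hy' : y = (-((1 - t) / t)) • x := by
        rw [neg_smul, div_eq_inv_mul, mul_smul, ht', smul_neg, neg_neg, smul_smul,
          inv_mul_cancel₀ ht0'.ne', one_smul]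
      have : a • x + b • y = (a - b * ((1 - t) / t)) • x := by
        conv_lhs => rw [hy']
        module
      rw [this]
      refine hscale _ _ ?_ ?_ hx
      · have h2 : b * (1 - t) < a * t := by
          have h3 : b < a * (t / (1 - t)) := by linarith
          rwa [← mul_div_assoc, lt_div_iff₀ h1] at h3
        have : b * ((1 - t) / t) ≤ a := by
          rw [← mul_div_assoc, div_le_iff₀ ht0']
          exact h2.le
        linarith
      · have : 0 ≤ b * ((1 - t) / t) := by positivity
        linarith
  · push Not at hz
    have hD := fun t ht => contDiffAt_half_sq hsm (hz t ht)
    have hconv : ConvexOn ℝ (Icc (0 : ℝ) 1) (fun s => N (x + s • (y - x)) ^ 2 / 2) := by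
      refine convexOn_of_hasDerivWithinAt2_nonneg (convex_Icc 0 1)
        (fun t ht => (hasDerivAt_comp_line (hD t ht)).continuousAt.continuousWithinAt)
        (fun t ht => (hasDerivAt_comp_line (hD t (interior_subset ht))).hasDerivWithinAt)
        (fun t ht => (hasDerivAt_fderiv_comp_line (hD t (interior_subset ht))).hasDerivWithinAt)
        (fun t ht => (hess _ _ (hz t (interior_subset ht)) (sub_ne_zero.2 hxy)).le)
    have h1 := hconv.2 (left_mem_Icc.2 zero_le_one) (right_mem_Icc.2 zero_le_one) ha.le hb.le hab
    simp only [smul_eq_mul, mul_zero, zero_add, mul_one, zero_smul, add_zero, one_smul,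
      add_sub_cancel] at h1
    have h2 : x + b • (y - x) = a • x + b • y := by
      rw [show a = 1 - b by linarith]; module
    rw [h2] at h1
    have h3 : N (a • x + b • y) ^ 2 < 1 := by
      have h4 : N x ^ 2 < 1 := pow_lt_one₀ (nonneg x) hx two_ne_zero
      have h5 : N y ^ 2 < 1 := pow_lt_one₀ (nonneg y) hy two_ne_zero
      nlinarith
    nlinarith [nonneg (a • x + b • y)]

theorem isMinkowskiNorm_of_hessian_pos [FiniteDimensional ℝ E] (nonneg : ∀ v, 0 ≤ N v)
    (homog : ∀ (c : ℝ) (v : E), 0 ≤ c → N (c • v) = c * N v)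
    (hsm : ContDiffOn ℝ 2 N {0}ᶜ)
    (hess : ∀ v w : E, v ≠ 0 → w ≠ 0 →
      0 < iteratedFDeriv ℝ 2 (fun u : E => N u ^ 2 / 2) v ![w, w]) :
    IsMinkowskiNorm N where
  nonneg := nonneg
  map_smul := homog
  pos _ hv := pos_of_hessian_pos nonneg homog hsm hess hv
  continuous := continuous_of_homogeneous nonneg homog hsm.continuousOn
  add_le v w := by
    refine le_of_forall_pos_lt_add fun ε hε => ?_
    -- `v` and `w` are multiples of points `v'`, `w'` of the open unit ball
    have hv : 0 < N v + ε / 2 := by linarith [nonneg v]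
    have hw : 0 < N w + ε / 2 := by linarith [nonneg w]
    have hs : 0 < N v + N w + ε := by linarith
    have h1 : ∀ u, 0 < N u + ε / 2 → N ((N u + ε / 2)⁻¹ • u) < 1 := by
      intro u hu
      rw [homog _ _ (by positivity), inv_mul_lt_one₀ hu]
      linarith
    have h2 := convex_ball_of_hessian_pos nonneg homog hsm hess (h1 v hv) (h1 w hw)
      (a := (N v + ε / 2) / (N v + N w + ε)) (b := (N w + ε / 2) / (N v + N w + ε))
      (by positivity) (by positivity) (by field_simp; ring)
    have h3 : ((N v + ε / 2) / (N v + N w + ε)) • (N v + ε / 2)⁻¹ • v +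
        ((N w + ε / 2) / (N v + N w + ε)) • (N w + ε / 2)⁻¹ • w =
        (N v + N w + ε)⁻¹ • (v + w) := by
      rw [smul_smul, smul_smul, smul_add]
      congr 2
      · rw [div_mul_eq_mul_div, mul_inv_cancel₀ hv.ne', one_div]
      · rw [div_mul_eq_mul_div, mul_inv_cancel₀ hw.ne', one_div]
    rw [h3, mem_ofPred_eq, homog _ _ (by positivity), inv_mul_lt_one₀ hs] at h2
    exact h2

end Hessian

section Fiber

variable {n : ℕ} {M : Type*} [TopologicalSpace M] [ChartedSpace (EucSp n) M]
  [IsManifold (𝓡 n) ∞ M]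

theorem contMDiff_tangentBundle_mk (x : M) :
    ContMDiff 𝓘(ℝ, EucSp n) (𝓡 n).tangent ∞
      (fun v : EucSp n => (⟨x, v⟩ : TangentBundle (𝓡 n) M)) := by
  intro v
  rw [Bundle.contMDiffAt_totalSpace]
  refine ⟨contMDiffAt_const, ?_⟩
  have hx : x ∈ (trivializationAt (EucSp n) (TangentSpace (𝓡 n)) x).baseSet :=
    FiberBundle.mem_baseSet_trivializationAt' x
  refine ContMDiffAt.congr_of_eventuallyEq (f := fun v : EucSp n =>
    ((trivializationAt (EucSp n) (TangentSpace (𝓡 n)) x).continuousLinearMapAt ℝ x :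
      EucSp n →L[ℝ] EucSp n) v) ?_ (Eventually.of_forall fun w => ?_)
  · exact ContinuousLinearMap.contMDiff _ v
  · exact (Bundle.Trivialization.continuousLinearMapAt_apply_of_mem (R := ℝ) _ hx w).symm

theorem FinslerMetric.isMinkowskiNorm (F : FinslerMetric n M) (x : M) :
    IsMinkowskiNorm (fun v : EucSp n => F.toFun x v) := by
  refine isMinkowskiNorm_of_hessian_pos (F.nonneg x) (fun c v hc => F.homogeneous x c v hc) ?_
    (F.strongly_convex x)
  have h1 : ContMDiffOn 𝓘(ℝ, EucSp n) 𝓘(ℝ, ℝ) ∞ (fun v : EucSp n => F.toFun x v) {0}ᶜ :=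
    F.smooth.comp (contMDiff_tangentBundle_mk x).contMDiffOn fun v hv => hv
  exact (contMDiffOn_iff_contDiffOn.1 h1).of_le (WithTop.coe_le_coe.2 (le_top : (2 : ℕ∞) ≤ ⊤))

end Fiber

/-! ### The Legendre transform -/

section Legendre

variable {E : Type*} [NormedAddCommGroup E] [NormedSpace ℝ E] {N : E → ℝ}

/-- At a maximizer `v` of `α - N² / 2` the derivative along the ray through `v` vanishes. -/
theorem apply_eq_sq_of_maximizer (homog : ∀ (c : ℝ) (v : E), 0 ≤ c → N (c • v) = c * N v)
    {α : E →L[ℝ] ℝ} {v : E} (hv : ∀ w, α w - N w ^ 2 / 2 ≤ α v - N v ^ 2 / 2) :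
    α v = N v ^ 2 := by
  by_contra hne
  set δ := α v - N v ^ 2 with hδ
  have hδ0 : 0 < |δ| := abs_pos.2 (sub_ne_zero.2 hne)
  have hd : 0 < N v ^ 2 + |δ| := by positivity
  have key : ∀ s : ℝ, -1 ≤ s → s * δ ≤ s ^ 2 * N v ^ 2 / 2 := by
    intro s hs
    have h1 := hv ((1 + s) • v)
    rw [homog _ _ (by linarith), map_smul, smul_eq_mul] at h1
    rw [hδ]
    nlinarith
  -- the parameter for which the linear term beats the quadratic one
  have h2 := key (δ / (N v ^ 2 + |δ|)) (by
    rw [le_div_iff₀ hd]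
    nlinarith [neg_abs_le δ, sq_nonneg (N v)])
  have h3 : δ / (N v ^ 2 + |δ|) * δ = δ ^ 2 / (N v ^ 2 + |δ|) ^ 2 * (N v ^ 2 + |δ|) := by
    field_simp
  rw [h3, div_pow] at h2
  have h4 : 0 < δ ^ 2 / (N v ^ 2 + |δ|) ^ 2 := by
    have : 0 < δ ^ 2 := by rw [← sq_abs]; positivity
    positivity
  nlinarith [sq_nonneg (N v), mul_pos h4 hδ0, mul_nonneg h4.le (sq_nonneg (N v))]

namespace IsMinkowskiNorm

variable (hN : IsMinkowskiNorm N)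
include hN

theorem map_zero : N 0 = 0 := by simpa using hN.map_smul 0 0 le_rfl

theorem exists_pos_mul_norm_le [FiniteDimensional ℝ E] : ∃ c : ℝ, 0 < c ∧ ∀ v, c * ‖v‖ ≤ N v := by
  rcases (Metric.sphere (0 : E) 1).eq_empty_or_nonempty with he | hne
  · refine ⟨1, one_pos, fun v => ?_⟩
    have : v = 0 := by
      by_contra hv
      have : ‖v‖⁻¹ • v ∈ Metric.sphere (0 : E) 1 := by
        simp [norm_smul, norm_ne_zero_iff.2 hv]
      simp [he] at this
    simp [this, hN.map_zero]
  · obtain ⟨u, hu, hmin⟩ := (isCompact_sphere (0 : E) 1).exists_isMinOn hne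
      hN.continuous.continuousOn
    refine ⟨N u, hN.pos u ?_, fun v => ?_⟩
    · rintro rfl
      simp at hu
    · by_cases hv : v = 0
      · simp [hv, hN.map_zero]
      have hn : 0 < ‖v‖ := norm_pos_iff.2 hv
      have h1 : N u ≤ N (‖v‖⁻¹ • v) := hmin (by simp [norm_smul, hn.ne'])
      rwa [hN.map_smul _ _ (by positivity), le_inv_mul_iff₀ hn, mul_comm] at h1

theorem isCompact_closedBall [FiniteDimensional ℝ E] : IsCompact {v | N v ≤ 1} := by
  obtain ⟨c, hc, hcN⟩ := hN.exists_pos_mul_norm_le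
  refine Metric.isCompact_of_isClosed_isBounded (isClosed_le hN.continuous continuous_const) ?_
  refine (Metric.isBounded_closedBall (x := (0 : E)) (r := c⁻¹)).subset fun v hv => ?_
  rw [mem_closedBall_zero_iff, ← one_div, le_div_iff₀ hc, mul_comm]
  exact (hcN v).trans hv

theorem exists_maximizer [FiniteDimensional ℝ E] (α : E →L[ℝ] ℝ) :
    ∃ v, ∀ w, α w - N w ^ 2 / 2 ≤ α v - N v ^ 2 / 2 := by
  obtain ⟨c, hc, hcN⟩ := hN.exists_pos_mul_norm_le
  refine Continuous.exists_forall_ge' (f := fun w => α w - N w ^ 2 / 2) (x₀ := 0)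
    (by have := hN.continuous; fun_prop) ?_
  have h1 : ∀ᶠ w : E in cocompact E, 2 * ‖α‖ / c ^ 2 ≤ ‖w‖ :=
    (tendsto_norm_cocompact_atTop (E := E)).eventually_ge_atTop _
  filter_upwards [h1] with w hw
  have h2 : α w ≤ ‖α‖ * ‖w‖ := (le_abs_self _).trans (α.le_opNorm w)
  have h3 : (c * ‖w‖) ^ 2 ≤ N w ^ 2 := by
    have := hcN w
    gcongr
  rw [div_le_iff₀ (by positivity)] at hw
  have h4 : 2 * ‖α‖ * ‖w‖ ≤ (c * ‖w‖) ^ 2 := by nlinarith [norm_nonneg w]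
  simp only [_root_.map_zero, hN.map_zero]
  linarith

/-- The maximum of `α - N² / 2` bounds the dual norm of `α` from above. -/
theorem apply_le_of_maximizer {α : E →L[ℝ] ℝ} {v : E}
    (hv : ∀ w, α w - N w ^ 2 / 2 ≤ α v - N v ^ 2 / 2) (w : E) : α w ≤ N v * N w := by
  rcases le_or_gt (α w) 0 with h0 | h0
  · exact h0.trans (mul_nonneg (hN.nonneg v) (hN.nonneg w))
  have hw : 0 < N w := hN.pos w (by rintro rfl; simp at h0)
  have h1 := hv ((α w / N w ^ 2) • w)
  rw [hN.map_smul _ _ (by positivity), _root_.map_smul, smul_eq_mul,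
    apply_eq_sq_of_maximizer hN.map_smul hv] at h1
  have h2 : α w / N w ^ 2 * α w - (α w / N w ^ 2 * N w) ^ 2 / 2 = (α w / N w) ^ 2 / 2 := by
    field_simp
    ring
  rw [h2] at h1
  have h3 : (α w / N w) ^ 2 ≤ N v ^ 2 := by linarith
  have h4 := (sq_le_sq₀ (by positivity) (hN.nonneg v)).1 h3
  rwa [div_le_iff₀ hw] at h4

end IsMinkowskiNorm

end Legendre

/-! ### Second moments of the unit ball of a Minkowski norm -/

theorem setOf_lt_subset_setOf_le {E : Type*} (N : E → ℝ) (r : ℝ) :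
    {v | N v < r} ⊆ {v | N v ≤ r} :=
  fun v (hv : N v < r) => show N v ≤ r from hv.le

namespace IsMinkowskiNorm

variable {n : ℕ} {N : EucSp n → ℝ} (hN : IsMinkowskiNorm N)
include hN

theorem measurableSet_ball : MeasurableSet {v | N v < 1} :=
  (isOpen_lt hN.continuous continuous_const).measurableSet

theorem volume_ball_lt_top : volume {v | N v < 1} < ⊤ :=
  (measure_mono (setOf_lt_subset_setOf_le N 1)).trans_lt hN.isCompact_closedBall.measure_lt_top

theorem volume_real_ball_pos : 0 < volume.real {v | N v < 1} := by
  refine ENNReal.toReal_pos (IsOpen.measure_pos volume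
    (isOpen_lt hN.continuous continuous_const) ⟨0, ?_⟩).ne' hN.volume_ball_lt_top.ne
  simp [hN.map_zero]

theorem integrableOn_ball {f : EucSp n → ℝ} (hf : Continuous f) :
    IntegrableOn f {v | N v < 1} :=
  (hf.continuousOn.integrableOn_compact hN.isCompact_closedBall).mono_set
    (setOf_lt_subset_setOf_le N 1)

theorem integral_sq_le {κ h : ℝ} (hκ1 : 1 ≤ κ) (hκ : ∀ v, N v ≤ κ * N (-v)) (hh : 0 ≤ h)
    {α : EucSp n →L[ℝ] ℝ} (hα : ∀ w, α w ≤ h * N w) :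
    ∫ v in {v | N v < 1}, α v ^ 2 ≤ κ ^ 2 * h ^ 2 * volume.real {v | N v < 1} := by
  have h1 : ∫ v in {v | N v < 1}, α v ^ 2 ≤ ∫ v in {v | N v < 1}, κ ^ 2 * h ^ 2 := by
    refine setIntegral_mono_on (hN.integrableOn_ball (by fun_prop))
      (hN.integrableOn_ball continuous_const) hN.measurableSet_ball fun v hv => ?_
    have hv1 : N v ≤ 1 := le_of_lt hv
    rw [← mul_pow, ← sq_abs (α v)]
    have h2 : α v ≤ κ * h := by
      have := hα v
      nlinarith [hN.nonneg v]
    have h3 : -α v ≤ κ * h := by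
      have h4 := hα (-v)
      have h5 := hκ (-v)
      rw [map_neg] at h4
      rw [neg_neg] at h5
      nlinarith [hN.nonneg v]
    have := abs_le'.2 ⟨h2, h3⟩
    gcongr
  rwa [setIntegral_const, smul_eq_mul, mul_comm] at h1

/-- The contraction `v ↦ (1 - s) v + s v₀` maps the unit ball into itself, which gives a lower bound
for the second moment of a linear form that is large at `v₀`. The sign condition disposes of the
first moment. -/
theorem sq_mul_volume_le_of_sign {v₀ : EucSp n} (hv₀ : N v₀ ≤ 1) (α : EucSp n →L[ℝ] ℝ)
    (hsign : 0 ≤ α v₀ * ∫ v in {v | N v < 1}, α v) {s : ℝ} (hs : 0 < s) (hs1 : s < 1) :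
    (1 - s) ^ n * s * α v₀ ^ 2 * volume.real {v | N v < 1} ≤
      (n + 2) * ∫ v in {v | N v < 1}, α v ^ 2 := by
  set B := {v | N v < 1} with hB
  have hr : 0 < 1 - s := by linarith
  set I := ∫ v in B, α v ^ 2 with hI
  have hI0 : 0 ≤ I := integral_nonneg fun v => sq_nonneg _
  set φ : EucSp n → ℝ := B.indicator fun v => α v ^ 2 with hφ
  have hφi : Integrable φ :=
    (hN.integrableOn_ball (f := fun v => α v ^ 2) (by fun_prop)).integrable_indicator
      hN.measurableSet_ball
  have hint : ∫ w, φ ((1 - s) • w + s • v₀) = ((1 - s) ^ n)⁻¹ * I := by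
    have h1 := Measure.integral_comp_smul volume (fun w => φ (w + s • v₀)) (1 - s)
    rw [integral_add_right_eq_self, integral_indicator hN.measurableSet_ball,
      finrank_euclideanSpace_fin, abs_of_pos (by positivity), smul_eq_mul] at h1
    exact h1
  have hφ2 : Integrable fun w => φ ((1 - s) • w + s • v₀) :=
    ((hφi.comp_add_right (s • v₀)).comp_smul hr.ne')
  have hle : ∫ w in B, (α ((1 - s) • w + s • v₀)) ^ 2 ≤ ((1 - s) ^ n)⁻¹ * I := by
    rw [← hint, ← integral_indicator hN.measurableSet_ball]
    refine integral_mono ((hN.integrableOn_ball (by fun_prop)).integrable_indicator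
      hN.measurableSet_ball) hφ2 fun w => ?_
    by_cases hw : w ∈ B
    · have hw' : (1 - s) • w + s • v₀ ∈ B := by
        have h1 := hN.add_le ((1 - s) • w) (s • v₀)
        rw [hN.map_smul _ _ hr.le, hN.map_smul _ _ hs.le] at h1
        have h2 : N w < 1 := hw
        show N _ < 1
        nlinarith
      rw [indicator_of_mem hw, hφ, indicator_of_mem hw']
    · rw [indicator_of_notMem hw]
      exact indicator_nonneg (fun v _ => sq_nonneg _) _
  have hexp : ∫ w in B, (α ((1 - s) • w + s • v₀)) ^ 2 =
      (1 - s) ^ 2 * I + 2 * s * (1 - s) * (α v₀ * ∫ v in B, α v) +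
        s ^ 2 * α v₀ ^ 2 * volume.real B := by
    have h1 : ∀ w, (α ((1 - s) • w + s • v₀)) ^ 2 = (1 - s) ^ 2 * α w ^ 2 +
        2 * s * (1 - s) * α v₀ * α w + s ^ 2 * α v₀ ^ 2 := by
      intro w
      simp only [map_add, _root_.map_smul, smul_eq_mul]
      ring
    simp_rw [h1]
    rw [integral_add, integral_add, integral_const_mul, integral_const_mul, setIntegral_const,
      smul_eq_mul]
    · ring
    all_goals exact hN.integrableOn_ball (by fun_prop)
  rw [hexp, ← div_eq_inv_mul, le_div_iff₀ (by positivity)] at hle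
  have hbern : 1 - (n + 2) * s ≤ (1 - s) ^ (n + 2) := by
    have := one_add_mul_le_pow (show (-2 : ℝ) ≤ -s by linarith) (n + 2)
    push_cast at this
    rw [← sub_eq_add_neg] at this
    linarith
  have hm : 0 ≤ 2 * s * (1 - s) * (α v₀ * ∫ v in B, α v) * (1 - s) ^ n := by positivity
  have hfin : s * ((1 - s) ^ n * s * α v₀ ^ 2 * volume.real B) ≤ s * ((n + 2) * I) := by
    have h1 : (1 - s) ^ (n + 2) * I ≥ (1 - (n + 2) * s) * I :=
      mul_le_mul_of_nonneg_right hbern hI0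
    rw [pow_add] at h1
    linarith
  exact le_of_mul_le_mul_left hfin hs

/-- A lower bound for the second moment of a linear form. The contraction argument is applied to
`v₀` or to `-v₀ / κ`, whichever has the right sign, with `s = 1 / (2n)`. -/
theorem sq_mul_volume_le (hn : 1 ≤ n) {κ : ℝ} (hκ1 : 1 ≤ κ) (hκ : ∀ v, N v ≤ κ * N (-v))
    {v₀ : EucSp n} (hv₀ : N v₀ ≤ 1) (α : EucSp n →L[ℝ] ℝ) :
    α v₀ ^ 2 * volume.real {v | N v < 1} ≤
      4 * n * κ ^ 2 * ((n + 2) * ∫ v in {v | N v < 1}, α v ^ 2) := by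
  have hn' : (1 : ℝ) ≤ n := by exact_mod_cast hn
  have hκ0 : 0 < κ := by linarith
  set s : ℝ := 1 / (2 * n) with hs
  have hs0 : 0 < s := by positivity
  have hsn : n * s = 1 / 2 := by rw [hs]; field_simp
  have hs1 : s < 1 := by nlinarith
  have hpow : 1 / 2 ≤ (1 - s) ^ n := by
    have := one_add_mul_le_pow (show (-2 : ℝ) ≤ -s by linarith) n
    rw [← sub_eq_add_neg] at this
    linarith
  set V := volume.real {v | N v < 1} with hV
  have hV0 : 0 < V := hN.volume_real_ball_pos
  set I := ∫ v in {v | N v < 1}, α v ^ 2 with hI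
  have hI0 : 0 ≤ I := integral_nonneg fun v => sq_nonneg _
  have fin : ∀ a : ℝ, (1 - s) ^ n * s * a ^ 2 * V ≤ (n + 2) * I →
      a ^ 2 * V ≤ 4 * n * ((n + 2) * I) := by
    intro a ha
    have h1 : 1 / 2 * s * a ^ 2 * V ≤ (1 - s) ^ n * s * a ^ 2 * V := by gcongr
    have h2 : 4 * n * (1 / 2 * s * a ^ 2 * V) = a ^ 2 * V := by
      rw [show 4 * n * (1 / 2 * s * a ^ 2 * V) = 2 * (n * s) * (a ^ 2 * V) by ring, hsn]
      ring
    rw [← h2]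
    exact mul_le_mul_of_nonneg_left (h1.trans ha) (by positivity)
  rcases le_total 0 (α v₀ * ∫ v in {v | N v < 1}, α v) with h | h
  · have h1 := fin _ (hN.sq_mul_volume_le_of_sign hv₀ α h hs0 hs1)
    refine h1.trans ?_
    have h2 : 0 ≤ 4 * n * ((n + 2) * I) := by positivity
    have h3 : 1 ≤ κ ^ 2 := one_le_pow₀ hκ1
    nlinarith [mul_le_mul_of_nonneg_right h3 h2]
  · have h0 : α (-(κ⁻¹ • v₀)) = -(κ⁻¹ * α v₀) := by simp
    have hv₁ : N (-(κ⁻¹ • v₀)) ≤ 1 := by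
      have h1 := hκ (-(κ⁻¹ • v₀))
      rw [neg_neg, hN.map_smul _ _ (by positivity), mul_inv_cancel_left₀ hκ0.ne'] at h1
      exact h1.trans hv₀
    have h1 := fin _ (hN.sq_mul_volume_le_of_sign hv₁ α (by
      rw [h0, neg_mul, mul_assoc]
      have : 0 ≤ κ⁻¹ := by positivity
      nlinarith) hs0 hs1)
    rw [h0, neg_sq, mul_pow, inv_pow, mul_assoc, inv_mul_le_iff₀ (by positivity)] at h1
    linarith

/-- The normalized second moment of `α` is bounded by a multiple of the square of its dual norm, which
is `N v` for a maximizer `v` of `α - N² / 2`. -/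
theorem moment_le_of_maximizer {κ : ℝ} (hκ1 : 1 ≤ κ) (hκ : ∀ v, N v ≤ κ * N (-v))
    {α : EucSp n →L[ℝ] ℝ} {v : EucSp n} (hv : ∀ w, α w - N w ^ 2 / 2 ≤ α v - N v ^ 2 / 2) :
    ((n : ℝ) + 2) / volume.real {v | N v < 1} * ∫ v in {v | N v < 1}, α v ^ 2 ≤
      ((n : ℝ) + 2) * κ ^ 2 * N v ^ 2 := by
  have hV := hN.volume_real_ball_pos
  have h1 := hN.integral_sq_le hκ1 hκ (hN.nonneg v) (hN.apply_le_of_maximizer hv)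
  rw [div_mul_eq_mul_div, div_le_iff₀ hV]
  calc _ ≤ ((n : ℝ) + 2) * (κ ^ 2 * N v ^ 2 * volume.real {v | N v < 1}) :=
        mul_le_mul_of_nonneg_left h1 (by positivity)
    _ = _ := by ring

theorem sq_le_moment_of_maximizer (hn : 1 ≤ n) {κ : ℝ} (hκ1 : 1 ≤ κ)
    (hκ : ∀ v, N v ≤ κ * N (-v)) {α : EucSp n →L[ℝ] ℝ} {v : EucSp n}
    (hv : ∀ w, α w - N w ^ 2 / 2 ≤ α v - N v ^ 2 / 2) :
    N v ^ 2 ≤ 4 * n * κ ^ 2 *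
      (((n : ℝ) + 2) / volume.real {v | N v < 1} * ∫ v in {v | N v < 1}, α v ^ 2) := by
  have hV := hN.volume_real_ball_pos
  rcases (hN.nonneg v).eq_or_lt with hz | hpos
  · rw [← hz, zero_pow two_ne_zero]
    have : 0 ≤ ∫ v in {v | N v < 1}, α v ^ 2 := integral_nonneg fun v => sq_nonneg _
    positivity
  -- the unit vector in the direction of `v`
  have hunit : N ((N v)⁻¹ • v) = 1 := by
    rw [hN.map_smul _ _ (by positivity), inv_mul_cancel₀ hpos.ne']
  have hval : α ((N v)⁻¹ • v) = N v := by
    rw [_root_.map_smul, apply_eq_sq_of_maximizer hN.map_smul hv, smul_eq_mul]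
    field_simp
  have h1 := hN.sq_mul_volume_le hn hκ1 hκ hunit.le α
  rw [hval, ← le_div_iff₀ hV] at h1
  refine h1.trans_eq ?_
  ring

end IsMinkowskiNorm

/-! ### The moment matrix of a convex body -/

/-- The matrix `(n + 2) / vol(B) * ∫_B vᵢ vⱼ dv` of normalized second moments of `B ⊆ ℝⁿ`. -/
noncomputable def momentMatrix {n : ℕ} (B : Set (EucSp n)) : Matrix (Fin n) (Fin n) ℝ :=
  Matrix.of fun i j => ((n : ℝ) + 2) / volume.real B * ∫ v in B, v i * v j

theorem isHermitian_momentMatrix {n : ℕ} (B : Set (EucSp n)) :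
    (momentMatrix B).IsHermitian := by
  ext i j
  simp only [momentMatrix, Matrix.conjTranspose_apply, Matrix.of_apply, star_trivial]
  congr 2
  ext v
  ring

open scoped Pointwise in
/-- The layer cake formula for a `2`-homogeneous function. -/
theorem setIntegral_one_sub_of_homogeneous {n : ℕ} {Q : EucSp n → ℝ} (hc : Continuous Q)
    (h0 : ∀ v, 0 ≤ Q v) (hQ : ∀ (t : ℝ) v, Q (t • v) = t ^ 2 * Q v)
    (hint : IntegrableOn (fun v => 1 - Q v) {v | Q v < 1}) :
    ∫ v in {v | Q v < 1}, (1 - Q v) = 2 / (n + 2) * volume.real {v | Q v < 1} := by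
  set V := volume.real {v | Q v < 1} with hV
  have hm : MeasurableSet {v | Q v < 1} := (isOpen_lt hc continuous_const).measurableSet
  have hnn : 0 ≤ᵐ[volume.restrict {v | Q v < 1}] fun v => 1 - Q v := by
    filter_upwards [ae_restrict_mem hm] with v hv
    have : Q v < 1 := hv
    simp only [Pi.zero_apply]
    linarith
  rw [Integrable.integral_eq_integral_meas_lt hint hnn]
  have hlevel : ∀ t : ℝ, 0 < t → (volume.restrict {v | Q v < 1}).real {v | t < 1 - Q v} =
      (Ioo (0 : ℝ) 1).indicator (fun t => (1 - t) ^ ((n : ℝ) / 2) * V) t := by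
    intro t ht
    have hsub : {v | t < 1 - Q v} ∩ {v | Q v < 1} = {v | Q v < 1 - t} := by
      ext v
      simp only [mem_inter_iff, mem_ofPred_eq]
      constructor
      · rintro ⟨h1, -⟩
        linarith
      · intro h
        constructor <;> linarith
    have hm' : MeasurableSet {v | t < 1 - Q v} :=
      (isOpen_lt continuous_const (continuous_const.sub hc)).measurableSet
    rw [measureReal_restrict_apply hm', hsub]
    rcases lt_or_ge t 1 with h1 | h1
    · rw [indicator_of_mem (show t ∈ Ioo (0 : ℝ) 1 from ⟨ht, h1⟩)]
      have hpos : 0 < 1 - t := by linarith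
      have hsq : 0 < Real.sqrt (1 - t) := Real.sqrt_pos.2 hpos
      have hset : {v | Q v < 1 - t} = Real.sqrt (1 - t) • {v | Q v < 1} := by
        ext v
        rw [mem_smul_set_iff_inv_smul_mem₀ hsq.ne']
        simp only [mem_ofPred_eq]
        rw [hQ, inv_pow, Real.sq_sqrt hpos.le, inv_mul_lt_one₀ hpos]
      rw [hset, measureReal_def, Measure.addHaar_smul_of_nonneg _ hsq.le, ENNReal.toReal_mul,
        ENNReal.toReal_ofReal (by positivity), finrank_euclideanSpace_fin, Real.sqrt_eq_rpow,
        ← Real.rpow_natCast, ← Real.rpow_mul hpos.le, hV, measureReal_def]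
      congr 2
      ring
    · rw [indicator_of_notMem (fun h => by linarith [h.2])]
      have : {v | Q v < 1 - t} = ∅ := by
        ext v
        simp only [mem_ofPred_eq, mem_empty_iff_false, iff_false, not_lt]
        linarith [h0 v]
      rw [this, measureReal_empty]
  rw [setIntegral_congr_fun measurableSet_Ioi hlevel, setIntegral_indicator measurableSet_Ioo,
    inter_eq_right.2 Ioo_subset_Ioi_self, ← integral_Ioc_eq_integral_Ioo,
    ← intervalIntegral.integral_of_le zero_le_one, intervalIntegral.integral_mul_const,
    intervalIntegral.integral_comp_sub_left (fun t => t ^ ((n : ℝ) / 2)) 1,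
    integral_rpow (Or.inl (by have : (0 : ℝ) ≤ n := n.cast_nonneg; linarith))]
  have h2 : (n : ℝ) / 2 + 1 ≠ 0 := by positivity
  have h3 : (n : ℝ) + 2 ≠ 0 := by positivity
  rw [sub_self, sub_zero, Real.one_rpow, Real.zero_rpow h2]
  field_simp
  ring

/-- Bathtub principle: `{Q < 1}` is where `1 - Q` is positive. -/
theorem setIntegral_one_sub_le {n : ℕ} {Q : EucSp n → ℝ} (hc : Continuous Q) {B : Set (EucSp n)}
    (hB : MeasurableSet B) (hiB : IntegrableOn (fun v => 1 - Q v) B)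
    (hiQ : IntegrableOn (fun v => 1 - Q v) {v | Q v < 1}) :
    ∫ v in B, (1 - Q v) ≤ ∫ v in {v | Q v < 1}, (1 - Q v) := by
  have hm : MeasurableSet {v | Q v < 1} := (isOpen_lt hc continuous_const).measurableSet
  rw [← integral_indicator hB, ← integral_indicator hm]
  refine integral_mono (hiB.integrable_indicator hB) (hiQ.integrable_indicator hm) fun v => ?_
  by_cases h1 : v ∈ B <;> by_cases h2 : v ∈ {v | Q v < 1}
  · simp [indicator_of_mem h1, indicator_of_mem h2]
  · rw [indicator_of_mem h1, indicator_of_notMem h2]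
    simp only [mem_ofPred_eq, not_lt] at h2
    linarith
  · rw [indicator_of_notMem h1, indicator_of_mem h2]
    simp only [mem_ofPred_eq] at h2
    linarith
  · simp [indicator_of_notMem h1, indicator_of_notMem h2]

theorem det_toEuclideanLin {n : ℕ} (S : Matrix (Fin n) (Fin n) ℝ) :
    LinearMap.det (Matrix.toEuclideanLin S) = S.det := by
  change LinearMap.det (Matrix.toLpLin 2 2 S) = S.det
  rw [Matrix.toLpLin_eq_toLin, LinearMap.det_toLin]

namespace IsMinkowskiNorm

variable {n : ℕ} {N : EucSp n → ℝ} (hN : IsMinkowskiNorm N)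
include hN

theorem mul_momentMatrix_mul_transpose_apply {m : ℕ} (S : Matrix (Fin m) (Fin n) ℝ)
    (i j : Fin m) :
    (S * momentMatrix {v | N v < 1} * S.transpose) i j =
      ((n : ℝ) + 2) / volume.real {v | N v < 1} *
        ∫ v in {v | N v < 1}, (S.mulVec v) i * (S.mulVec v) j := by
  have h1 : ∀ v : EucSp n, (S.mulVec v) i * (S.mulVec v) j =
      ∑ l, ∑ k, S i k * S j l * (v k * v l) := by
    intro v
    simp only [Matrix.mulVec, dotProduct, Finset.sum_mul_sum]
    rw [Finset.sum_comm]
    exact Finset.sum_congr rfl fun l _ => Finset.sum_congr rfl fun k _ => by ring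
  simp_rw [h1]
  rw [integral_finsetSum _ fun l _ => hN.integrableOn_ball (by fun_prop), Finset.mul_sum,
    Matrix.mul_apply]
  refine Finset.sum_congr rfl fun l _ => ?_
  rw [integral_finsetSum _ fun k _ => hN.integrableOn_ball (by fun_prop), Finset.mul_sum,
    Matrix.mul_apply, Finset.sum_mul]
  refine Finset.sum_congr rfl fun k _ => ?_
  rw [integral_const_mul, momentMatrix, Matrix.of_apply, Matrix.transpose_apply]
  ring

theorem dotProduct_momentMatrix_mulVec (a : Fin n → ℝ) :
    a ⬝ᵥ (momentMatrix {v | N v < 1}).mulVec a =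
      ((n : ℝ) + 2) / volume.real {v | N v < 1} * ∫ v in {v | N v < 1}, (a ⬝ᵥ v) ^ 2 := by
  have h := hN.mul_momentMatrix_mul_transpose_apply (m := 1) (Matrix.of fun _ => a) 0 0
  have h1 : ∀ v : EucSp n, ((Matrix.of fun _ : Fin 1 => a).mulVec v) 0 = a ⬝ᵥ v := fun v => rfl
  simp_rw [h1, ← sq] at h
  rw [← h, Matrix.mul_assoc, Matrix.mul_apply]
  rfl

theorem posDef_momentMatrix : (momentMatrix {v | N v < 1}).PosDef := by
  refine Matrix.PosDef.of_dotProduct_mulVec_pos (isHermitian_momentMatrix _) fun a ha => ?_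
  rw [star_trivial, hN.dotProduct_momentMatrix_mulVec]
  refine mul_pos (div_pos (by positivity) hN.volume_real_ball_pos) ?_
  have hcont : Continuous fun v : EucSp n => (a ⬝ᵥ v) ^ 2 := by
    simp only [dotProduct]
    fun_prop
  rw [setIntegral_pos_iff_support_of_nonneg_ae (Eventually.of_forall fun v => sq_nonneg _)
    (hN.integrableOn_ball hcont)]
  refine IsOpen.measure_pos volume ((hcont.isOpen_support).inter
    (isOpen_lt hN.continuous continuous_const)) ?_
  -- a small multiple of the vector `a` itself lies in the ball
  set w : EucSp n := WithLp.toLp 2 a with hw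
  have hNw : 0 < N w + 1 := by linarith [hN.nonneg w]
  refine ⟨(N w + 1)⁻¹ • w, ?_, ?_⟩
  · have h1 : a ⬝ᵥ ((N w + 1)⁻¹ • w : EucSp n) = (N w + 1)⁻¹ * (a ⬝ᵥ a) := by
      rw [← smul_eq_mul, ← dotProduct_smul]
      rfl
    simp only [Function.mem_support, h1]
    have h2 : a ⬝ᵥ a ≠ 0 := fun h => ha (dotProduct_self_eq_zero.1 h)
    positivity
  · show N _ < 1
    rw [hN.map_smul _ _ (by positivity), inv_mul_lt_one₀ hNw]
    linarith

/-- The body is no larger than the ellipsoid `{Q < 1}` dual to its moment matrix, because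
`∫_B (1 - Q) = 2 / (n + 2) * vol(B)`, and the same formula holds for the ellipsoid. -/
theorem volume_mul_sqrt_det_inv_momentMatrix_le :
    volume.real {v | N v < 1} * Real.sqrt (momentMatrix {v | N v < 1})⁻¹.det ≤ unitBallVol n := by
  set B := {v | N v < 1} with hB
  set P := momentMatrix B with hP
  have hPd : P.PosDef := hN.posDef_momentMatrix
  obtain ⟨S, hS⟩ : ∃ S : Matrix (Fin n) (Fin n) ℝ, P⁻¹ = S.transpose * S := by
    open scoped MatrixOrder in
    obtain ⟨S, hS⟩ := CStarAlgebra.nonneg_iff_eq_star_mul_self.mp hPd.inv.posSemidef.nonneg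
    exact ⟨S, hS⟩
  have hdet : P⁻¹.det = S.det ^ 2 := by rw [hS, Matrix.det_mul, Matrix.det_transpose, sq]
  have hS0 : S.det ≠ 0 := fun h => by
    have := hPd.inv.det_pos
    rw [hdet, h] at this
    simp at this
  set L : EucSp n →ₗ[ℝ] EucSp n := Matrix.toEuclideanLin S with hL
  have hLdet : LinearMap.det L = S.det := det_toEuclideanLin S
  have hLc : Continuous L := L.continuous_of_finiteDimensional
  set Q : EucSp n → ℝ := fun v => ‖L v‖ ^ 2 with hQ
  have hQc : Continuous Q := by fun_prop
  have hE : {v | Q v < 1} = L ⁻¹' Metric.ball 0 1 := by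
    ext v
    simp only [hQ, mem_ofPred_eq, mem_preimage, mem_ball_zero_iff]
    exact pow_lt_one_iff_of_nonneg (norm_nonneg _) two_ne_zero
  have hvE : volume {v | Q v < 1} =
      ENNReal.ofReal |S.det⁻¹| * volume (Metric.ball (0 : EucSp n) 1) := by
    rw [hE, Measure.addHaar_preimage_linearMap _ (by rwa [hLdet]), hLdet]
  have hvEr : volume.real {v | Q v < 1} = |S.det|⁻¹ * unitBallVol n := by
    rw [measureReal_def, hvE, ENNReal.toReal_mul, ENNReal.toReal_ofReal (abs_nonneg _), abs_inv]
    rfl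
  have hiQ : IntegrableOn (fun v => 1 - Q v) {v | Q v < 1} := by
    refine Measure.integrableOn_of_bounded (M := 1) ?_ (by fun_prop) ?_
    · rw [hvE]
      exact ENNReal.mul_ne_top ENNReal.ofReal_ne_top measure_ball_lt_top.ne
    · filter_upwards [ae_restrict_mem (isOpen_lt hQc continuous_const).measurableSet] with v hv
      have h1 : Q v < 1 := hv
      have h2 : 0 ≤ Q v := sq_nonneg _
      rw [Real.norm_eq_abs, abs_le]
      constructor <;> linarith
  have hE' := setIntegral_one_sub_of_homogeneous hQc (fun v => sq_nonneg _)
    (fun t v => by simp [hQ, norm_smul, mul_pow]) hiQ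
  have hV : 0 < volume.real B := hN.volume_real_ball_pos
  have hIQ : ∫ v in B, Q v = n / (n + 2) * volume.real B := by
    have h1 : ∀ v, Q v = ∑ i, (S.mulVec v) i * (S.mulVec v) i := by
      intro v
      simp only [hQ, EuclideanSpace.norm_sq_eq, Real.norm_eq_abs, sq_abs]
      exact Finset.sum_congr rfl fun i _ => sq _
    have hc : ∀ i, Continuous fun v : EucSp n => (S.mulVec v) i * (S.mulVec v) i := by
      intro i
      simp only [Matrix.mulVec, dotProduct]
      fun_prop
    have h2 : (S * P * S.transpose).trace = n := by
      rw [Matrix.trace_mul_comm, ← Matrix.mul_assoc, ← hS,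
        Matrix.nonsing_inv_mul _ hPd.det_pos.ne'.isUnit, Matrix.trace_one, Fintype.card_fin]
    simp_rw [h1]
    rw [integral_finsetSum _ fun i _ => hN.integrableOn_ball (hc i)]
    have h3 : (S * P * S.transpose).trace = ((n : ℝ) + 2) / volume.real B *
        ∑ i, ∫ v in B, (S.mulVec v) i * (S.mulVec v) i := by
      rw [Matrix.trace, Finset.mul_sum]
      exact Finset.sum_congr rfl fun i _ => hN.mul_momentMatrix_mul_transpose_apply S i i
    rw [h2] at h3
    have : (n : ℝ) + 2 ≠ 0 := by positivity
    rw [div_mul_eq_mul_div, eq_div_iff hV.ne'] at h3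
    rw [div_mul_eq_mul_div, eq_div_iff this, h3, mul_comm]
  have hle := setIntegral_one_sub_le hQc hN.measurableSet_ball (hN.integrableOn_ball (by fun_prop))
    hiQ
  rw [hE', integral_sub (hN.integrableOn_ball (by fun_prop)) (hN.integrableOn_ball hQc), hIQ,
    setIntegral_const, smul_eq_mul, mul_one, hvEr] at hle
  have h2 : volume.real B - n / (n + 2) * volume.real B = 2 / (n + 2) * volume.real B := by
    field_simp
    ring
  rw [h2] at hle
  have h3 := le_of_mul_le_mul_left hle (by positivity)
  rw [hdet, Real.sqrt_sq_eq_abs]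
  rwa [le_inv_mul_iff₀ (abs_pos.2 hS0), mul_comm] at h3

theorem sum_le {ι : Type*} (s : Finset ι) (v : ι → EucSp n) :
    N (∑ i ∈ s, v i) ≤ ∑ i ∈ s, N (v i) := by
  classical
  induction s using Finset.induction_on with
  | empty => simp [hN.map_zero]
  | insert i s hi ih =>
    rw [Finset.sum_insert hi, Finset.sum_insert hi]
    exact (hN.add_le _ _).trans (by linarith)

/-- Auerbach's lemma: there is a basis of vectors of the closed unit ball, here the columns of `A`,
in which all vectors of the ball have coordinates of absolute value at most `1`. -/
theorem exists_auerbach_basis :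
    ∃ A : Matrix (Fin n) (Fin n) ℝ, A.det ≠ 0 ∧
      (∀ i, N (WithLp.toLp 2 (A.col i)) ≤ 1) ∧
      ∀ v : EucSp n, N v ≤ 1 → ∀ i, |(A⁻¹.mulVec v) i| ≤ 1 := by
  classical
  set K : Set (EucSp n) := {v | N v ≤ 1} with hK
  set D : (Fin n → EucSp n) → ℝ := fun V => |(Matrix.of fun j i => V i j).det| with hD
  have hDc : Continuous D := by
    refine continuous_abs.comp (Continuous.matrix_det (continuous_matrix fun j i => ?_))
    simp only [Matrix.of_apply]
    fun_prop
  have hKc : IsCompact (Set.pi univ fun _ : Fin n => K) :=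
    isCompact_univ_pi fun _ => hN.isCompact_closedBall
  have h0 : (fun _ => 0 : Fin n → EucSp n) ∈ Set.pi univ fun _ : Fin n => K := by
    intro i _
    simp [hK, hN.map_zero]
  obtain ⟨V, hV, hmax⟩ := hKc.exists_isMaxOn ⟨_, h0⟩ hDc.continuousOn
  set A : Matrix (Fin n) (Fin n) ℝ := Matrix.of fun j i => V i j with hA
  have hdet : A.det ≠ 0 := by
    -- the multiples of the standard basis vectors that lie in the ball have nonzero determinant
    set r : Fin n → ℝ := fun i => (N (EuclideanSpace.single i 1) + 1)⁻¹ with hr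
    have hr0 : ∀ i, 0 < r i := fun i => by
      have := hN.nonneg (EuclideanSpace.single i 1)
      positivity
    have hmem : (fun i => r i • EuclideanSpace.single i (1 : ℝ)) ∈
        Set.pi univ fun _ : Fin n => K := by
      intro i _
      have h1 := hN.nonneg (EuclideanSpace.single i 1)
      show N _ ≤ 1
      rw [hN.map_smul _ _ (hr0 i).le, hr, inv_mul_le_one₀ (by linarith)]
      linarith
    have h1 := hmax hmem
    have h2 : (Matrix.of fun j i => (r i • EuclideanSpace.single i (1 : ℝ) : EucSp n) j) =
        Matrix.diagonal r := by
      ext j i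
      by_cases hij : j = i
      · subst hij
        simp
      · simp [hij]
    have h3 : D (fun i => r i • EuclideanSpace.single i (1 : ℝ)) = |∏ i, r i| := by
      simp only [hD]
      rw [h2, Matrix.det_diagonal]
    intro hz
    have h4 : D V = 0 := by
      show |A.det| = 0
      rw [hz, abs_zero]
    have h5 : |∏ i, r i| ≤ 0 := by
      rw [← h3, ← h4]
      exact h1
    exact (abs_pos.2 (Finset.prod_pos fun i _ => hr0 i).ne').not_ge h5
  refine ⟨A, hdet, fun i => hV i (mem_univ i), fun v hv i => ?_⟩
  have h1 : (A⁻¹.mulVec v) i = A.det⁻¹ * (A.updateCol i v).det := by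
    rw [← Matrix.cramer_apply, ← Matrix.det_smul_inv_mulVec_eq_cramer A v hdet.isUnit,
      Pi.smul_apply, smul_eq_mul, inv_mul_cancel_left₀ hdet]
  have hmem : Function.update V i v ∈ Set.pi univ fun _ : Fin n => K := by
    intro j _
    by_cases hj : j = i
    · subst hj
      rw [Function.update_self]
      exact hv
    · simpa [hj] using hV j (mem_univ j)
  have h2 : (A.updateCol i v) = Matrix.of fun j k => (Function.update V i v) k j := by
    ext j k
    by_cases hk : k = i
    · subst hk
      simp
    · simp [hk, hA]
  have h3 : |(A.updateCol i v).det| ≤ |A.det| := by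
    rw [h2]
    exact hmax hmem
  rw [h1, abs_mul, abs_inv]
  exact inv_mul_le_one_of_le₀ h3 (abs_nonneg _)

/-- An upper bound for the moment matrix in terms of the volume. In an Auerbach basis the second
moments are bounded, and the body contains the image of a cube of side `1 / n`. -/
theorem det_momentMatrix_le (hn : 1 ≤ n) :
    (momentMatrix {v | N v < 1}).det ≤
      (n.factorial * ((n : ℝ) + 2) ^ n * (n : ℝ) ^ (2 * n)) * volume.real {v | N v < 1} ^ 2 := by
  obtain ⟨A, hA, hAN, hAK⟩ := hN.exists_auerbach_basis
  have hV : 0 < volume.real {v | N v < 1} := hN.volume_real_ball_pos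
  have hn0 : (0 : ℝ) < n := by exact_mod_cast hn
  have hdet : (momentMatrix {v | N v < 1}).det ≤ n.factorial * ((n : ℝ) + 2) ^ n * A.det ^ 2 := by
    set R := A⁻¹ * momentMatrix {v | N v < 1} * A⁻¹.transpose with hR
    have h1 : ∀ i j, |R i j| ≤ (n : ℝ) + 2 := by
      intro i j
      rw [hR, hN.mul_momentMatrix_mul_transpose_apply, abs_mul, abs_of_pos (by positivity)]
      have h2 : |∫ v in {v | N v < 1}, (A⁻¹.mulVec v) i * (A⁻¹.mulVec v) j| ≤
          1 * volume.real {v | N v < 1} := by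
        rw [← Real.norm_eq_abs]
        refine norm_setIntegral_le_of_norm_le_const hN.volume_ball_lt_top fun v hv => ?_
        have hv' : N v ≤ 1 := le_of_lt hv
        rw [norm_mul, Real.norm_eq_abs, Real.norm_eq_abs]
        exact mul_le_one₀ (hAK v hv' i) (abs_nonneg _) (hAK v hv' j)
      calc _ ≤ ((n : ℝ) + 2) / volume.real {v | N v < 1} * (1 * volume.real {v | N v < 1}) := by
            gcongr
        _ = (n : ℝ) + 2 := by field_simp
    have h3 := Matrix.det_le (abv := AbsoluteValue.abs) h1
    rw [Fintype.card_fin, nsmul_eq_mul] at h3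
    have h4 : R.det = (momentMatrix {v | N v < 1}).det / A.det ^ 2 := by
      rw [hR, Matrix.det_mul, Matrix.det_mul, Matrix.det_transpose, Matrix.det_nonsing_inv,
        Ring.inverse_eq_inv']
      field_simp
    have h5 : R.det ≤ n.factorial * ((n : ℝ) + 2) ^ n := (le_abs_self _).trans h3
    rwa [h4, div_le_iff₀ (by positivity)] at h5
  have hvol : |A.det| ≤ (n : ℝ) ^ n * volume.real {v | N v < 1} := by
    set L : EucSp n →ₗ[ℝ] EucSp n := Matrix.toEuclideanLin A with hL
    set C : Set (EucSp n) := WithLp.ofLp ⁻¹' (Set.pi univ fun _ => Ioo (0 : ℝ) (1 / n)) with hC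
    have hCv : volume C = ENNReal.ofReal ((1 / n) ^ n) := by
      rw [hC, (PiLp.volume_preserving_ofLp (Fin n)).measure_preimage
        (MeasurableSet.univ_pi fun _ => measurableSet_Ioo).nullMeasurableSet,
        Real.volume_pi_Ioo]
      simp [ENNReal.ofReal_pow, -inv_pow]
    have hsub : L '' C ⊆ {v | N v < 1} := by
      rintro _ ⟨t, ht, rfl⟩
      have ht' : ∀ i, 0 < t i ∧ t i < 1 / n := fun i => ht i (mem_univ i)
      have h1 : L t = ∑ i, t i • (WithLp.toLp 2 (A.col i) : EucSp n) := by
        ext j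
        simp [hL, Matrix.mulVec, dotProduct, mul_comm]
      show N (L t) < 1
      rw [h1]
      calc N (∑ i, t i • (WithLp.toLp 2 (A.col i) : EucSp n))
          ≤ ∑ i, N (t i • (WithLp.toLp 2 (A.col i) : EucSp n)) := hN.sum_le _ _
        _ ≤ ∑ i, t i := Finset.sum_le_sum fun i _ => by
            rw [hN.map_smul _ _ (ht' i).1.le]
            exact mul_le_of_le_one_right (ht' i).1.le (hAN i)
        _ < ∑ _i : Fin n, 1 / (n : ℝ) :=
            Finset.sum_lt_sum_of_nonempty ⟨⟨0, hn⟩, Finset.mem_univ _⟩ fun i _ => (ht' i).2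
        _ = 1 := by simp [hn0.ne']
    have h2 : volume (L '' C) ≤ volume {v | N v < 1} := measure_mono hsub
    rw [Measure.addHaar_image_linearMap, hL, det_toEuclideanLin, hCv] at h2
    have h3 := ENNReal.toReal_mono hN.volume_ball_lt_top.ne h2
    rw [ENNReal.toReal_mul, ENNReal.toReal_ofReal (abs_nonneg _),
      ENNReal.toReal_ofReal (by positivity), div_pow, one_pow, mul_one_div,
      div_le_iff₀ (by positivity), mul_comm] at h3
    exact h3
  have h6 : A.det ^ 2 ≤ (n : ℝ) ^ (2 * n) * volume.real {v | N v < 1} ^ 2 := by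
    rw [← sq_abs A.det, mul_comm 2 n, pow_mul, ← mul_pow]
    gcongr
  calc _ ≤ n.factorial * ((n : ℝ) + 2) ^ n * A.det ^ 2 := hdet
    _ ≤ n.factorial * ((n : ℝ) + 2) ^ n *
        ((n : ℝ) ^ (2 * n) * volume.real {v | N v < 1} ^ 2) := by gcongr
    _ = _ := by ring

end IsMinkowskiNorm

/-! ### Comparison of the volumes in charts -/

theorem unitBallVol_pos (n : ℕ) : 0 < unitBallVol n :=
  ENNReal.toReal_pos (Metric.measure_ball_pos volume _ one_pos).ne' measure_ball_lt_top.ne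

section DensityMeasure

variable {n : ℕ} {M : Type*} [TopologicalSpace M] [ChartedSpace (EucSp n) M]

theorem densityMeasure_le_smul [MeasurableSpace M] [BorelSpace M]
    {ρ ρ' : OpenPartialHomeomorph M (EucSp n) → EucSp n → ℝ≥0∞} {c : ℝ≥0∞} (hc : c ≠ ⊤)
    (h : ∀ e ∈ IsManifold.maximalAtlas (𝓡 n) ∞ M, ∀ y ∈ e.target, ρ e y ≤ c * ρ' e y) :
    densityMeasure ρ ≤ c • densityMeasure (M := M) ρ' := by
  refine iSup₂_le fun e he => ?_
  have hmeas : ∀ f : EucSp n → ℝ≥0∞,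
      AEMeasurable e.symm ((volume.restrict e.target).withDensity f) := fun f =>
    (e.continuousOn_symm.aemeasurable e.open_target.measurableSet).mono_ac
      (withDensity_absolutelyContinuous _ _)
  calc Measure.map e.symm ((volume.restrict e.target).withDensity (ρ e))
      ≤ Measure.map e.symm ((volume.restrict e.target).withDensity (c • ρ' e)) := by
        refine Measure.map_mono_of_aemeasurable (withDensity_mono ?_) (hmeas _)
        filter_upwards [ae_restrict_mem e.open_target.measurableSet] with y hy using h e he y hy
    _ = c • Measure.map e.symm ((volume.restrict e.target).withDensity (ρ' e)) := by
        rw [withDensity_smul' _ _ hc, Measure.map_smul]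
    _ ≤ c • densityMeasure ρ' := by
        have : Measure.map e.symm ((volume.restrict e.target).withDensity (ρ' e)) ≤
            densityMeasure ρ' :=
          le_iSup₂ (f := fun (e : OpenPartialHomeomorph M (EucSp n))
            (_ : e ∈ IsManifold.maximalAtlas (𝓡 n) ∞ M) =>
              Measure.map e.symm ((volume.restrict e.target).withDensity (ρ' e))) e he
        gcongr

theorem exists_continuousLinearEquiv_chartVec {e : OpenPartialHomeomorph M (EucSp n)}
    (he : e ∈ IsManifold.maximalAtlas (𝓡 n) ∞ M) {y : EucSp n} (hy : y ∈ e.target) :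
    ∃ L : EucSp n ≃L[ℝ] EucSp n, ∀ a, chartVec e y a = L a := by
  have hd : e.MDifferentiable (𝓡 n) (𝓡 n) :=
    ⟨(contMDiffOn_of_mem_maximalAtlas he).mdifferentiableOn (by norm_num),
      (contMDiffOn_symm_of_mem_maximalAtlas he).mdifferentiableOn (by norm_num)⟩
  exact ⟨hd.symm.mfderiv hy, fun a => rfl⟩

end DensityMeasure

theorem volume_real_preimage_continuousLinearEquiv {n : ℕ} (L : EucSp n ≃L[ℝ] EucSp n)
    (B : Set (EucSp n)) :
    volume.real (L ⁻¹' B) =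
      |LinearMap.det (L.toLinearEquiv : EucSp n →ₗ[ℝ] EucSp n)|⁻¹ * volume.real B := by
  have hdet : LinearMap.det (L.toLinearEquiv : EucSp n →ₗ[ℝ] EucSp n) ≠ 0 :=
    (LinearEquiv.isUnit_det' L.toLinearEquiv).ne_zero
  have h := Measure.addHaar_preimage_linearMap volume hdet B
  rw [measureReal_def, measureReal_def]
  have h' : volume (L ⁻¹' B) = _ := h
  rw [h', ENNReal.toReal_mul, ENNReal.toReal_ofReal (abs_nonneg _), abs_inv]

/-- The Gram determinant of a bilinear form in a basis that is the image of the standard one. -/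
theorem det_gram_map {n : ℕ} (G : Matrix (Fin n) (Fin n) ℝ) (L : EucSp n →ₗ[ℝ] EucSp n) :
    (Matrix.of fun i j : Fin n => ∑ k, ∑ l, G k l * L (EuclideanSpace.single i 1) k *
      L (EuclideanSpace.single j 1) l).det = LinearMap.det L ^ 2 * G.det := by
  set b := (EuclideanSpace.basisFun (Fin n) ℝ).toBasis with hb
  set T := LinearMap.toMatrix b b L with hT
  have h1 : (Matrix.of fun i j : Fin n => ∑ k, ∑ l, G k l * L (EuclideanSpace.single i 1) k *
      L (EuclideanSpace.single j 1) l) = T.transpose * G * T := by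
    ext i j
    have hTe : ∀ k i, T k i = L (EuclideanSpace.single i 1) k := by
      intro k i
      simp [hT, hb, LinearMap.toMatrix_apply]
    rw [Matrix.mul_apply, Matrix.of_apply, Finset.sum_comm]
    refine Finset.sum_congr rfl fun l _ => ?_
    rw [Matrix.mul_apply, Finset.sum_mul]
    refine Finset.sum_congr rfl fun k _ => ?_
    rw [Matrix.transpose_apply, hTe, hTe]
    ring
  rw [h1, Matrix.det_mul, Matrix.det_mul, Matrix.det_transpose, LinearMap.det_toMatrix]
  ring

namespace FinslerMetric

variable {n : ℕ} {M : Type*} [TopologicalSpace M] [ChartedSpace (EucSp n) M]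
  [IsManifold (𝓡 n) ∞ M] (F : FinslerMetric n M)

theorem binetDualMatrix_eq_momentMatrix (x : M) :
    F.binetDualMatrix x = momentMatrix {v : EucSp n | F.toFun x v < 1} := rfl

theorem sqrt_det_gram_binetLegendre (x : M) (L : EucSp n ≃L[ℝ] EucSp n) :
    Real.sqrt (Matrix.det (Matrix.of fun i j : Fin n =>
      F.binetLegendre x (L (EuclideanSpace.single i 1)) (L (EuclideanSpace.single j 1)))) =
      |LinearMap.det (L.toLinearEquiv : EucSp n →ₗ[ℝ] EucSp n)| *
        Real.sqrt (F.binetDualMatrix x)⁻¹.det := by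
  have h := det_gram_map (F.binetDualMatrix x)⁻¹ (L.toLinearEquiv : EucSp n →ₗ[ℝ] EucSp n)
  have h' : Matrix.det (Matrix.of fun i j : Fin n =>
      F.binetLegendre x (L (EuclideanSpace.single i 1)) (L (EuclideanSpace.single j 1))) = _ := h
  rw [h', Real.sqrt_mul (sq_nonneg _), Real.sqrt_sq_eq_abs]

variable [MeasurableSpace M] [BorelSpace M]

/-- The Binet–Legendre volume never exceeds the Busemann–Hausdorff measure. -/
theorem riemannianVol_binetLegendre_le : riemannianVol F.binetLegendre ≤ F.busemannHausdorff := by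
  have h : riemannianVol F.binetLegendre ≤ (1 : ℝ≥0∞) • F.busemannHausdorff := by
    refine densityMeasure_le_smul ENNReal.one_ne_top fun e he y hy => ?_
    obtain ⟨L, hL⟩ := exists_continuousLinearEquiv_chartVec he hy
    have hN := F.isMinkowskiNorm (e.symm y)
    have hV : 0 < volume.real {v : EucSp n | F.toFun (e.symm y) v < 1} := hN.volume_real_ball_pos
    have hd : 0 < |LinearMap.det (L.toLinearEquiv : EucSp n →ₗ[ℝ] EucSp n)| :=
      abs_pos.2 (LinearEquiv.isUnit_det' L.toLinearEquiv).ne_zero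
    rw [one_mul]
    refine ENNReal.ofReal_le_ofReal ?_
    simp only [hL]
    rw [F.sqrt_det_gram_binetLegendre,
      show {a : EucSp n | F.toFun (e.symm y) (L a) < 1} =
        L ⁻¹' {v : EucSp n | F.toFun (e.symm y) v < 1} from rfl,
      volume_real_preimage_continuousLinearEquiv, le_div_iff₀ (by positivity)]
    have h1 := hN.volume_mul_sqrt_det_inv_momentMatrix_le
    rw [← F.binetDualMatrix_eq_momentMatrix] at h1
    calc _ = volume.real {v : EucSp n | F.toFun (e.symm y) v < 1} *
          Real.sqrt (F.binetDualMatrix (e.symm y))⁻¹.det := by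
          field_simp
      _ ≤ _ := h1
  rwa [one_smul] at h

theorem busemannHausdorff_le (hn : 1 ≤ n) {k : ℝ}
    (hk : Real.sqrt (n.factorial * ((n : ℝ) + 2) ^ n * (n : ℝ) ^ (2 * n)) ≤ k ^ n) :
    F.busemannHausdorff ≤
      ENNReal.ofReal (unitBallVol n * k ^ n) • riemannianVol F.binetLegendre := by
  refine densityMeasure_le_smul ENNReal.ofReal_ne_top fun e he y hy => ?_
  obtain ⟨L, hL⟩ := exists_continuousLinearEquiv_chartVec he hy
  have hN := F.isMinkowskiNorm (e.symm y)
  have hV : 0 < volume.real {v : EucSp n | F.toFun (e.symm y) v < 1} := hN.volume_real_ball_pos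
  have hd : 0 < |LinearMap.det (L.toLinearEquiv : EucSp n →ₗ[ℝ] EucSp n)| :=
    abs_pos.2 (LinearEquiv.isUnit_det' L.toLinearEquiv).ne_zero
  have hω := unitBallVol_pos n
  have hk0 : 0 ≤ k ^ n := (Real.sqrt_nonneg _).trans hk
  rw [← ENNReal.ofReal_mul (by positivity)]
  refine ENNReal.ofReal_le_ofReal ?_
  simp only [hL]
  rw [F.sqrt_det_gram_binetLegendre,
    show {a : EucSp n | F.toFun (e.symm y) (L a) < 1} =
      L ⁻¹' {v : EucSp n | F.toFun (e.symm y) v < 1} from rfl,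
    volume_real_preimage_continuousLinearEquiv, div_le_iff₀ (by positivity),
    F.binetDualMatrix_eq_momentMatrix]
  set V := volume.real {v : EucSp n | F.toFun (e.symm y) v < 1}
  set P := momentMatrix {v : EucSp n | F.toFun (e.symm y) v < 1}
  have hP : 0 < P.det := hN.posDef_momentMatrix.det_pos
  have h1 : P.det ≤ (n.factorial * ((n : ℝ) + 2) ^ n * (n : ℝ) ^ (2 * n)) * V ^ 2 :=
    hN.det_momentMatrix_le hn
  have h2 : Real.sqrt P.det ≤ k ^ n * V := by
    refine (Real.sqrt_le_sqrt h1).trans ?_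
    rw [Real.sqrt_mul (by positivity), Real.sqrt_sq hV.le]
    gcongr
  rw [Matrix.det_nonsing_inv, Ring.inverse_eq_inv', Real.sqrt_inv]
  have hs : 0 < Real.sqrt P.det := Real.sqrt_pos.2 hP
  calc unitBallVol n = unitBallVol n * 1 := (mul_one _).symm
    _ ≤ unitBallVol n * (k ^ n * V / Real.sqrt P.det) := by
        gcongr
        rwa [one_le_div hs]
    _ = _ := by field_simp

/-- The volume comparison holds with a constant depending only on the dimension. -/
theorem exists_volumeComparison (hn : 1 ≤ n) :
    ∃ k₀ : ℝ, 0 < k₀ ∧ ∀ (M : Type*) [TopologicalSpace M] [ChartedSpace (EucSp n) M]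
      [IsManifold (𝓡 n) ∞ M] [MeasurableSpace M] [BorelSpace M] (F : FinslerMetric n M),
      F.VolumeComparison k₀ := by
  set P : ℝ := Real.sqrt (n.factorial * ((n : ℝ) + 2) ^ n * (n : ℝ) ^ (2 * n))
  set k₀ : ℝ := max 1 (max (unitBallVol n) P)
  have h1 : 1 ≤ k₀ := le_max_left _ _
  have hk : k₀ ≤ k₀ ^ n := le_self_pow₀ h1 (by omega)
  have hω : unitBallVol n ≤ k₀ ^ n :=
    ((le_max_left _ _).trans (le_max_right _ _)).trans hk
  have hP : P ≤ k₀ ^ n := ((le_max_right _ _).trans (le_max_right _ _)).trans hk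
  refine ⟨k₀, by linarith, fun M _ _ _ _ _ F => ⟨?_, F.busemannHausdorff_le hn hP⟩⟩
  have h2 : ENNReal.ofReal (unitBallVol n * (k₀ ^ n)⁻¹) ≤ 1 := by
    rw [ENNReal.ofReal_le_one, ← div_eq_mul_inv]
    exact div_le_one_of_le₀ hω (by positivity)
  calc ENNReal.ofReal (unitBallVol n * (k₀ ^ n)⁻¹) • riemannianVol F.binetLegendre
      ≤ (1 : ℝ≥0∞) • riemannianVol F.binetLegendre := by gcongr
    _ = riemannianVol F.binetLegendre := one_smul _ _
    _ ≤ F.busemannHausdorff := F.riemannianVol_binetLegendre_le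

end FinslerMetric

/-! ### Centring a function with respect to a finite measure -/

section Centring

theorem abs_rpow_sub_two_mul_self {p : ℝ} (hp : 1 < p) (t : ℝ) :
    |(|t| ^ (p - 2) * t)| = |t| ^ (p - 1) := by
  rcases eq_or_ne t 0 with rfl | ht
  · simp [Real.zero_rpow (show p - 1 ≠ 0 by linarith)]
  · have h : 0 < |t| := abs_pos.2 ht
    rw [abs_mul, abs_of_nonneg (by positivity), show p - 1 = p - 2 + 1 by ring,
      Real.rpow_add_one h.ne']

theorem continuous_abs_rpow_mul_self {p : ℝ} (hp : 1 < p) :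
    Continuous fun t : ℝ => |t| ^ (p - 2) * t := by
  have h : ContDiff ℝ 1 fun t : ℝ => ‖t‖ ^ p := contDiff_norm_rpow hp
  have h1 : Continuous (deriv fun t : ℝ => ‖t‖ ^ p) := h.continuous_deriv le_rfl
  have h2 : (deriv fun t : ℝ => ‖t‖ ^ p) = fun t => p * (|t| ^ (p - 2) * t) := by
    ext t
    simp only [Real.norm_eq_abs]
    rw [(hasDerivAt_abs_rpow t hp).deriv, mul_assoc]
  rw [h2] at h1
  have h3 := h1.const_mul p⁻¹
  have : p ≠ 0 := by linarith
  simpa [inv_mul_cancel_left₀ this] using h3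

/-- The graph of `|·|^p` lies above its tangents, by Young's inequality. -/
theorem abs_rpow_sub_le {p : ℝ} (hp : 1 < p) (t c : ℝ) :
    |t| ^ p - p * c * (|t| ^ (p - 2) * t) ≤ |t - c| ^ p := by
  have hp0 : 0 < p := by linarith
  set q := p.conjExponent with hq
  have hpq : p.HolderConjugate q := Real.HolderConjugate.conjExponent hp
  have h1 : (|t| ^ (p - 2) * t) * (t - c) ≤ |t| ^ (p - 1) * |t - c| := by
    rw [← abs_rpow_sub_two_mul_self hp, ← abs_mul]
    exact le_abs_self _
  have h2 := Real.young_inequality_of_nonneg (abs_nonneg (t - c))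
    (show 0 ≤ |t| ^ (p - 1) by positivity) hpq
  have h3 : (|t| ^ (p - 1)) ^ q = |t| ^ p := by
    rw [← Real.rpow_mul (abs_nonneg _), hpq.sub_one_mul_conj]
  have h4 : (|t| ^ (p - 2) * t) * t = |t| ^ p := by
    rcases eq_or_ne t 0 with rfl | ht
    · simp [Real.zero_rpow hp0.ne']
    · have h : 0 < |t| := abs_pos.2 ht
      have h5 : |t| ^ p = |t| ^ (p - 2) * |t| ^ 2 := by
        rw [← Real.rpow_natCast, ← Real.rpow_add h]
        norm_num
      rw [h5, sq_abs]
      ring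
  have h5 : 1 / q = 1 - 1 / p := by
    have := hpq.inv_add_inv_eq_one
    rw [one_div, one_div]
    linarith
  rw [h3] at h2
  have h6 : |t| ^ p / q = |t| ^ p - |t| ^ p / p := by
    rw [div_eq_mul_one_div, h5]
    ring
  have h7 : |t| ^ p / p - c * (|t| ^ (p - 2) * t) ≤ |t - c| ^ p / p := by
    nlinarith
  have h8 := mul_le_mul_of_nonneg_left h7 hp0.le
  rw [mul_sub, mul_div_cancel₀ _ hp0.ne', mul_div_cancel₀ _ hp0.ne'] at h8
  linarith

variable {X : Type*} [MeasurableSpace X] {ν : Measure X} {p : ℝ} {f : X → ℝ}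

theorem MeasureTheory.MemLp.integrable_abs_rpow (hp : 1 < p) (hf : MemLp f (ENNReal.ofReal p) ν) :
    Integrable (fun x => |f x| ^ p) ν := by
  have h := hf.integrable_norm_rpow (by simp; linarith) ENNReal.ofReal_ne_top
  rw [ENNReal.toReal_ofReal (by linarith)] at h
  exact h

theorem abs_rpow_sub_two_mul_self_le (hp : 1 < p) {s t : ℝ} (hst : |s| ≤ t) :
    ‖|s| ^ (p - 2) * s‖ ≤ 1 + |t| ^ p := by
  have ht : 0 ≤ t := (abs_nonneg s).trans hst
  rw [Real.norm_eq_abs, abs_rpow_sub_two_mul_self hp, abs_of_nonneg ht]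
  rcases le_total t 1 with h | h
  · have h1 : |s| ^ (p - 1) ≤ 1 :=
      Real.rpow_le_one (abs_nonneg _) (hst.trans h) (by linarith)
    have h2 : 0 ≤ t ^ p := by positivity
    linarith
  · have h1 : |s| ^ (p - 1) ≤ t ^ (p - 1) :=
      Real.rpow_le_rpow (abs_nonneg _) hst (by linarith)
    have h2 : t ^ (p - 1) ≤ t ^ p := Real.rpow_le_rpow_of_exponent_le h (by linarith)
    linarith

theorem integrable_abs_rpow_mul_self [IsFiniteMeasure ν] (hp : 1 < p)
    (hf : MemLp f (ENNReal.ofReal p) ν) : Integrable (fun x => |f x| ^ (p - 2) * f x) ν := by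
  refine ((integrable_const 1).add (hf.abs.integrable_abs_rpow hp)).mono'
    ((continuous_abs_rpow_mul_self hp).comp_aestronglyMeasurable hf.1)
    (Eventually.of_forall fun x => ?_)
  exact abs_rpow_sub_two_mul_self_le hp (le_refl |f x|)

/-- Every `f ∈ L^p` can be centred by subtracting a constant. The function
`θ ↦ ∫ ψ(cos θ f - sin θ)`, where `ψ(t) = |t|^{p-2} t`, is continuous and has opposite signs at
`±π / 2`; at a zero `θ` in between the constant is `tan θ`. -/
theorem exists_integral_abs_rpow_sub_eq_zero [IsFiniteMeasure ν] (hp : 1 < p)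
    (hf : MemLp f (ENNReal.ofReal p) ν) :
    ∃ c : ℝ, ∫ x, |f x - c| ^ (p - 2) * (f x - c) ∂ν = 0 := by
  rcases eq_or_ne ν 0 with rfl | hν
  · exact ⟨0, by simp⟩
  have hm : 0 < ν.real univ :=
    ENNReal.toReal_pos (by simpa using hν) (measure_ne_top _ _)
  set Θ : ℝ → ℝ := fun θ => ∫ x, |Real.cos θ * f x - Real.sin θ| ^ (p - 2) *
    (Real.cos θ * f x - Real.sin θ) ∂ν with hΘ
  have hcont : Continuous Θ := by
    refine continuous_of_dominated (bound := fun x => 1 + |(|f x| + 1)| ^ p) (fun θ => ?_)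
      (fun θ => Eventually.of_forall fun x => ?_) ?_ (Eventually.of_forall fun x => ?_)
    · exact (continuous_abs_rpow_mul_self hp).comp_aestronglyMeasurable
        ((hf.1.const_mul _).sub aestronglyMeasurable_const)
    · refine abs_rpow_sub_two_mul_self_le hp ?_
      refine (abs_sub _ _).trans (add_le_add ?_ (Real.abs_sin_le_one θ))
      rw [abs_mul]
      exact mul_le_of_le_one_left (abs_nonneg _) (Real.abs_cos_le_one θ)
    · exact (integrable_const 1).add
        ((hf.abs.add (memLp_const (1 : ℝ))).integrable_abs_rpow hp)
    · exact (continuous_abs_rpow_mul_self hp).comp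
        ((Real.continuous_cos.mul continuous_const).sub Real.continuous_sin)
  have h1 : Θ (Real.pi / 2) = -ν.real univ := by simp [hΘ]
  have h2 : Θ (-(Real.pi / 2)) = ν.real univ := by simp [hΘ]
  obtain ⟨θ, ⟨hθ1, hθ2⟩, hθ0⟩ := intermediate_value_Icc'
    (show -(Real.pi / 2) ≤ Real.pi / 2 by linarith [Real.pi_pos]) hcont.continuousOn
    (show (0 : ℝ) ∈ Icc (Θ (Real.pi / 2)) (Θ (-(Real.pi / 2))) by
      rw [h1, h2]
      constructor <;> linarith)
  have hc : 0 < Real.cos θ := by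
    refine Real.cos_pos_of_mem_Ioo ⟨lt_of_le_of_ne hθ1 ?_, lt_of_le_of_ne hθ2 ?_⟩
    · rintro rfl
      linarith
    · rintro rfl
      linarith
  refine ⟨Real.sin θ / Real.cos θ, ?_⟩
  have h3 : ∀ x, |Real.cos θ * f x - Real.sin θ| ^ (p - 2) * (Real.cos θ * f x - Real.sin θ) =
      Real.cos θ ^ (p - 2) * Real.cos θ * (|f x - Real.sin θ / Real.cos θ| ^ (p - 2) *
        (f x - Real.sin θ / Real.cos θ)) := by
    intro x
    have h4 : Real.cos θ * f x - Real.sin θ =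
        Real.cos θ * (f x - Real.sin θ / Real.cos θ) := by field_simp
    rw [h4, abs_mul, abs_of_pos hc, Real.mul_rpow hc.le (abs_nonneg _)]
    ring
  simp only [hΘ, h3] at hθ0
  rw [integral_const_mul] at hθ0
  exact (mul_eq_zero.1 hθ0).resolve_left (by positivity)

/-- A centred function is closest to `0` among its translates. -/
theorem integral_abs_rpow_le_of_centred [IsFiniteMeasure ν] (hp : 1 < p)
    (hf : MemLp f (ENNReal.ofReal p) ν) (h0 : ∫ x, |f x| ^ (p - 2) * f x ∂ν = 0) (c : ℝ) :
    ∫ x, |f x| ^ p ∂ν ≤ ∫ x, |f x - c| ^ p ∂ν := by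
  have h1 := integral_mono
    ((hf.integrable_abs_rpow hp).sub ((integrable_abs_rpow_mul_self hp hf).const_mul (p * c)))
    ((hf.sub (memLp_const c)).integrable_abs_rpow hp) fun x => abs_rpow_sub_le hp (f x) c
  have h2 := integral_sub (hf.integrable_abs_rpow hp)
    ((integrable_abs_rpow_mul_self hp hf).const_mul (p * c))
  rw [integral_const_mul, h0, mul_zero, sub_zero] at h2
  rw [← h2]
  exact h1

end Centring

/-! ### Comparison of eigenvalues -/

section Transfer

variable {n : ℕ} {M : Type*} [TopologicalSpace M] [ChartedSpace (EucSp n) M] [MeasurableSpace M]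

/-- The set of Rayleigh quotients whose infimum is the first eigenvalue. -/
def rayleighQuotients (N : (x : M) → TangentSpace (𝓡 n) x → ℝ) (m : Measure M) (p : ℝ) : Set ℝ :=
  {r : ℝ | ∃ (f : M → ℝ) (E : ℝ≥0), HasSobolevEnergy N m p f E ∧
    ¬ f =ᵐ[m] 0 ∧
    Integrable (fun x => |f x| ^ (p - 2) * f x) m ∧
    ∫ x, |f x| ^ (p - 2) * f x ∂m = 0 ∧
    r = (E : ℝ) / ∫ x, |f x| ^ p ∂m}

variable {N N' : (x : M) → TangentSpace (𝓡 n) x → ℝ} {μ ν : Measure M} {p : ℝ}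

theorem smoothEnergy_le (hp : 0 ≤ p) {B C : ℝ} (hC : 0 ≤ C)
    (hN : ∀ x v, 0 ≤ N x v) (hN' : ∀ x v, 0 ≤ N' x v)
    (hNN' : ∀ x α, N' x (legendre N' x α) ≤ C * N x (legendre N x α))
    (hνμ : ν ≤ ENNReal.ofReal B • μ) (u : M → ℝ) :
    smoothEnergy N' ν p u ≤ ENNReal.ofReal (C ^ p) * ENNReal.ofReal B * smoothEnergy N μ p u := by
  calc smoothEnergy N' ν p u
      ≤ ∫⁻ x, ENNReal.ofReal (C ^ p) * ENNReal.ofReal (N x (gradientVec N u x) ^ p)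
          ∂(ENNReal.ofReal B • μ) := by
        refine lintegral_mono' hνμ fun x => ?_
        rw [← ENNReal.ofReal_mul (by positivity), ← Real.mul_rpow hC (hN _ _)]
        exact ENNReal.ofReal_le_ofReal (Real.rpow_le_rpow (hN' _ _) (hNN' _ _) hp)
    _ = _ := by
        rw [lintegral_const_mul' _ _ ENNReal.ofReal_ne_top, lintegral_smul_measure, smul_eq_mul,
          ← mul_assoc]
        rfl

theorem smoothEnergy_sub_const {u : M → ℝ} (hu : MDifferentiable (𝓡 n) 𝓘(ℝ, ℝ) u) (c : ℝ) :
    smoothEnergy N μ p (fun x => u x - c) = smoothEnergy N μ p u := by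
  have h : ∀ x, mfderiv (𝓡 n) 𝓘(ℝ, ℝ) (fun x => u x - c) x = mfderiv (𝓡 n) 𝓘(ℝ, ℝ) u x := by
    intro x
    exact ((hu x).hasMFDerivAt.sub (hasMFDerivAt_const c x)).mfderiv.trans (sub_zero _)
  unfold smoothEnergy gradientVec
  simp_rw [h]

/-- A test function for `(N, μ)` becomes one for `(N', ν)` after subtraction of a constant. The
energies of the approximating functions are bounded, so they converge along a subsequence. -/
theorem exists_rayleighQuotient_le [IsFiniteMeasure μ] [IsFiniteMeasure ν] (hp : 1 < p)
    {A B C : ℝ} (hA : 0 < A) (hB : 0 < B) (hC : 0 ≤ C)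
    (hN : ∀ x v, 0 ≤ N x v) (hN' : ∀ x v, 0 ≤ N' x v)
    (hNN' : ∀ x α, N' x (legendre N' x α) ≤ C * N x (legendre N x α))
    (hμν : μ ≤ ENNReal.ofReal A • ν) (hνμ : ν ≤ ENNReal.ofReal B • μ)
    {r : ℝ} (hr : r ∈ rayleighQuotients N μ p) :
    ∃ r' ∈ rayleighQuotients N' ν p, r' ≤ C ^ p * A * B * r := by
  obtain ⟨f, E, ⟨hfL, u, hu, huL, huE, hlim, hcau, hE⟩, hf0, -, hfc, rfl⟩ := hr
  have hfν : MemLp f (ENNReal.ofReal p) ν := hfL.of_measure_le_smul ENNReal.ofReal_ne_top hνμ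
  obtain ⟨c, hc⟩ := exists_integral_abs_rpow_sub_eq_zero hp hfν
  have hfν' : MemLp (fun x => f x - c) (ENNReal.ofReal p) ν := hfν.sub (memLp_const c)
  set K : ℝ≥0∞ := ENNReal.ofReal (C ^ p) * ENNReal.ofReal B with hK
  have hKt : K ≠ ⊤ := ENNReal.mul_ne_top ENNReal.ofReal_ne_top ENNReal.ofReal_ne_top
  have hle : ∀ w : M → ℝ, smoothEnergy N' ν p w ≤ K * smoothEnergy N μ p w :=
    smoothEnergy_le (by linarith) hC hN hN' hNN' hνμ
  have hconst : ∀ j, smoothEnergy N' ν p (fun x => u j x - c) = smoothEnergy N' ν p (u j) :=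
    fun j => smoothEnergy_sub_const ((hu j).mdifferentiable (by norm_num)) c
  obtain ⟨E', -, φ, hφ, hE'⟩ := isCompact_univ.tendsto_subseq
    (x := fun j => smoothEnergy N' ν p (u j)) fun j => mem_univ _
  have hEφ : Tendsto (fun j => K * smoothEnergy N μ p (u (φ j))) atTop (𝓝 (K * E)) :=
    ENNReal.Tendsto.const_mul (hE.comp hφ.tendsto_atTop) (Or.inr hKt)
  have hEE' : E' ≤ K * E := le_of_tendsto_of_tendsto' hE' hEφ fun j => hle _
  have hE't : E' ≠ ⊤ := (hEE'.trans_lt (ENNReal.mul_lt_top hKt.lt_top ENNReal.coe_lt_top)).ne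
  have hac : μ ≪ ν := (Measure.absolutelyContinuous_of_le hμν).trans
    (Measure.smul_absolutelyContinuous)
  refine ⟨_, ⟨fun x => f x - c, E'.toNNReal, ⟨hfν', fun j x => u (φ j) x - c, fun j => ?_,
    fun j => ?_, fun j => ?_, ?_, ?_, ?_⟩, ?_, integrable_abs_rpow_mul_self hp hfν', hc, rfl⟩, ?_⟩
  · exact (hu _).sub contMDiff_const
  · exact ((huL _).of_measure_le_smul ENNReal.ofReal_ne_top hνμ).sub (memLp_const c)
  · rw [hconst]
    exact (hle _).trans_lt (ENNReal.mul_lt_top hKt.lt_top (huE _))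
  · have h1 : ∀ j, (fun x => u (φ j) x - c) - (fun x => f x - c) = u (φ j) - f := by
      intro j
      ext x
      simp
    simp_rw [h1]
    set a : ℝ≥0∞ := ENNReal.ofReal B ^ (1 / ENNReal.ofReal p).toReal with ha
    have hat : a ≠ ⊤ := ENNReal.rpow_ne_top_of_nonneg ENNReal.toReal_nonneg ENNReal.ofReal_ne_top
    have h2 : Tendsto (fun j => a * eLpNorm (u (φ j) - f) (ENNReal.ofReal p) μ) atTop (𝓝 0) := by
      have := ENNReal.Tendsto.const_mul (a := a) (hlim.comp hφ.tendsto_atTop) (Or.inr hat)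
      rwa [mul_zero] at this
    exact tendsto_of_tendsto_of_tendsto_of_le_of_le tendsto_const_nhds h2 (fun _ => zero_le)
      fun j => eLpNorm_le_of_measure_le_smul hνμ
  · intro ε hε
    obtain ⟨δ, hδ, hδε⟩ : ∃ δ : ℝ≥0∞, 0 < δ ∧ K * δ ≤ ε := by
      rcases eq_or_ne K 0 with h | h
      · exact ⟨1, one_pos, by simp [h]⟩
      · exact ⟨ε / K, ENNReal.div_pos hε.ne' hKt, ENNReal.mul_div_le⟩
    obtain ⟨J, hJ⟩ := hcau δ hδ
    refine ⟨J, fun i j hi hj => ?_⟩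
    have h1 : (fun x => u (φ i) x - c) - (fun x => u (φ j) x - c) = u (φ i) - u (φ j) := by
      ext x
      simp
    rw [h1]
    refine (hle _).trans (le_trans ?_ hδε)
    gcongr
    exact hJ _ _ (hi.trans (hφ.id_le i)) (hj.trans (hφ.id_le j))
  · simp_rw [hconst]
    rw [ENNReal.coe_toNNReal hE't]
    exact hE'
  · -- a function that is constant and centred for `μ` vanishes
    intro h
    refine hf0 ?_
    have hfc' : f =ᵐ[μ] fun _ => c := by
      filter_upwards [hac.ae_le h] with x hx
      exact sub_eq_zero.1 hx
    have h1 : ∫ x, |f x| ^ (p - 2) * f x ∂μ = ∫ _x, |c| ^ (p - 2) * c ∂μ :=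
      integral_congr_ae (hfc'.mono fun x hx => by simp only [hx])
    rw [hfc, integral_const, smul_eq_mul] at h1
    rcases mul_eq_zero.1 h1.symm with h2 | h2
    · have : μ = 0 := by
        rw [measureReal_def, ENNReal.toReal_eq_zero_iff] at h2
        exact Measure.measure_univ_eq_zero.1 (h2.resolve_right (measure_ne_top _ _))
      rw [this, ae_zero]
      exact eventually_bot
    · have : c = 0 := by
        by_contra hc0
        have : 0 < |c| := abs_pos.2 hc0
        exact mul_ne_zero (by positivity) hc0 h2
      rwa [this] at hfc'
  · have hI : 0 < ∫ x, |f x| ^ p ∂μ := by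
      refine (integral_nonneg fun x => by positivity).lt_of_ne' fun h => hf0 ?_
      rw [integral_eq_zero_iff_of_nonneg (fun x => by positivity)
        (hfL.integrable_abs_rpow hp)] at h
      filter_upwards [h] with x hx
      simpa using (Real.rpow_eq_zero (abs_nonneg _) (by linarith)).1 hx
    have hI1 := integral_abs_rpow_le_of_centred hp hfL hfc c
    have hI2 : ∫ x, |f x - c| ^ p ∂μ ≤ A * ∫ x, |f x - c| ^ p ∂ν := by
      have h1 := hfν'.integrable_abs_rpow hp
      have h2 := integral_mono_measure hμν (Eventually.of_forall fun x => by positivity)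
        (h1.smul_measure ENNReal.ofReal_ne_top)
      rwa [integral_smul_measure, ENNReal.toReal_ofReal hA.le, smul_eq_mul] at h2
    have hEr : (E'.toNNReal : ℝ) ≤ C ^ p * B * E := by
      have h1 := ENNReal.toReal_mono (ENNReal.mul_ne_top hKt ENNReal.coe_ne_top) hEE'
      rw [hK, ENNReal.toReal_mul, ENNReal.toReal_mul, ENNReal.toReal_ofReal (by positivity),
        ENNReal.toReal_ofReal hB.le] at h1
      exact h1
    set I := ∫ x, |f x| ^ p ∂μ
    set I' := ∫ x, |f x - c| ^ p ∂ν
    have hI' : 0 < I' := by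
      by_contra! h
      nlinarith
    rw [div_le_iff₀ hI']
    calc (E'.toNNReal : ℝ) ≤ C ^ p * B * E := hEr
      _ = C ^ p * B * E / I * I := by field_simp
      _ ≤ C ^ p * B * E / I * (A * I') := by
          have : I ≤ A * I' := hI1.trans hI2
          gcongr
      _ = C ^ p * A * B * (E / I) * I' := by ring

theorem rayleighQuotients_nonneg {r : ℝ} (hr : r ∈ rayleighQuotients N μ p) : 0 ≤ r := by
  obtain ⟨f, E, -, -, -, -, rfl⟩ := hr
  exact div_nonneg E.2 (integral_nonneg fun x => by positivity)

/-- The hypothesis is needed in both directions in order to know that one of the sets of Rayleigh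
quotients is empty if the other one is. -/
theorem firstEigenvalue_le [IsFiniteMeasure μ] [IsFiniteMeasure ν] (hp : 1 < p)
    {A B C : ℝ} (hA : 0 < A) (hB : 0 < B) (hC : 0 ≤ C)
    (hN : ∀ x v, 0 ≤ N x v) (hN' : ∀ x v, 0 ≤ N' x v)
    (hNN' : ∀ x α, N' x (legendre N' x α) ≤ C * N x (legendre N x α))
    (hN'N : ∀ x α, N x (legendre N x α) ≤ C * N' x (legendre N' x α))
    (hμν : μ ≤ ENNReal.ofReal A • ν) (hνμ : ν ≤ ENNReal.ofReal B • μ) :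
    firstEigenvalue N' ν p ≤ C ^ p * A * B * firstEigenvalue N μ p := by
  change sInf (rayleighQuotients N' ν p) ≤ C ^ p * A * B * sInf (rayleighQuotients N μ p)
  rcases (rayleighQuotients N μ p).eq_empty_or_nonempty with he | hne
  · have he' : rayleighQuotients N' ν p = ∅ := by
      by_contra hne'
      obtain ⟨r', hr'⟩ := nonempty_iff_ne_empty.2 hne'
      obtain ⟨r, hr, -⟩ := exists_rayleighQuotient_le hp hB hA hC hN' hN hN'N hνμ hμν hr'
      rw [he] at hr
      exact hr
    rw [he, he', Real.sInf_empty, mul_zero]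
  · have hbdd : BddBelow (rayleighQuotients N' ν p) := ⟨0, fun r hr => rayleighQuotients_nonneg hr⟩
    rw [← smul_eq_mul, ← Real.sInf_smul_of_nonneg (by positivity)]
    refine le_csInf hne.smul_set ?_
    rintro _ ⟨r, hr, rfl⟩
    obtain ⟨r', hr', h⟩ := exists_rayleighQuotient_le hp hA hB hC hN hN' hNN' hμν hνμ hr
    exact (csInf_le hbdd hr').trans h

end Transfer

/-! ### Comparison of the dual norms -/

namespace FinslerMetric

variable {n : ℕ} {M : Type*} [TopologicalSpace M] [ChartedSpace (EucSp n) M]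
  [IsManifold (𝓡 n) ∞ M] (F : FinslerMetric n M)

theorem legendre_spec (x : M) (α : TangentSpace (𝓡 n) x →L[ℝ] ℝ) (w : TangentSpace (𝓡 n) x) :
    α w - F.toFun x w ^ 2 / 2 ≤
      α (legendre F.toFun x α) - F.toFun x (legendre F.toFun x α) ^ 2 / 2 := by
  have h := (F.isMinkowskiNorm x).exists_maximizer (α : EucSp n →L[ℝ] ℝ)
  exact Classical.epsilon_spec (p := fun v => ∀ w : TangentSpace (𝓡 n) x,
    α w - F.toFun x w ^ 2 / 2 ≤ α v - F.toFun x v ^ 2 / 2) h w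

theorem binetLegendre_eq_dotProduct (x : M) (v w : EucSp n) :
    F.binetLegendre x v w = v ⬝ᵥ (F.binetDualMatrix x)⁻¹.mulVec w := by
  simp only [binetLegendre, dotProduct, Matrix.mulVec, Finset.mul_sum]
  exact Finset.sum_congr rfl fun i _ => Finset.sum_congr rfl fun j _ => by ring

theorem posDef_binetDualMatrix (x : M) : (F.binetDualMatrix x).PosDef :=
  (F.isMinkowskiNorm x).posDef_momentMatrix

theorem binetLegendre_self_nonneg (x : M) (v : EucSp n) : 0 ≤ F.binetLegendre x v v := by
  rw [binetLegendre_eq_dotProduct]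
  simpa using (F.posDef_binetDualMatrix x).inv.posSemidef.dotProduct_mulVec_nonneg (v : Fin n → ℝ)

theorem metricNorm_binetLegendre_nonneg (x : M) (v : TangentSpace (𝓡 n) x) :
    0 ≤ metricNorm F.binetLegendre x v :=
  Real.sqrt_nonneg _

theorem metricNorm_binetLegendre_sq (x : M) (v : EucSp n) :
    metricNorm F.binetLegendre x v ^ 2 = F.binetLegendre x v v :=
  Real.sq_sqrt (F.binetLegendre_self_nonneg x v)

theorem metricNorm_binetLegendre_smul (x : M) (c : ℝ) (v : EucSp n) (hc : 0 ≤ c) :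
    metricNorm F.binetLegendre x (c • v) = c * metricNorm F.binetLegendre x v := by
  have h : F.binetLegendre x (c • v) (c • v) = c ^ 2 * F.binetLegendre x v v := by
    simp only [binetLegendre, Finset.mul_sum, PiLp.smul_apply, smul_eq_mul]
    exact Finset.sum_congr rfl fun i _ => Finset.sum_congr rfl fun j _ => by ring
  show Real.sqrt (F.binetLegendre x (c • v) (c • v)) = c * Real.sqrt (F.binetLegendre x v v)
  rw [h, Real.sqrt_mul (sq_nonneg c), Real.sqrt_sq hc]

/-- The `g_F`-norm of the `g_F`-gradient is the dual norm of the differential. The maximizer is the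
vector `g_F^* α`, as one sees by completing the square. -/
theorem metricNorm_legendre_sq (x : M) (α : EucSp n →L[ℝ] ℝ) :
    metricNorm F.binetLegendre x (legendre (metricNorm F.binetLegendre) x α) ^ 2 =
      F.binetDual x α α := by
  set N : EucSp n → ℝ := metricNorm F.binetLegendre x with hN
  set P := F.binetDualMatrix x with hP
  have hPd : P.PosDef := F.posDef_binetDualMatrix x
  have hPu : IsUnit P.det := hPd.det_pos.ne'.isUnit
  set a : Fin n → ℝ := fun i => α (EuclideanSpace.single i 1) with ha
  have hα : ∀ w : EucSp n, α w = a ⬝ᵥ w := by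
    intro w
    conv_lhs => rw [← (EuclideanSpace.basisFun (Fin n) ℝ).sum_repr w]
    simp [dotProduct, ha, mul_comm]
  set v₀ : EucSp n := WithLp.toLp 2 (P.mulVec a) with hv₀
  have hGv₀ : P⁻¹.mulVec v₀ = a := by
    show P⁻¹.mulVec (P.mulVec a) = a
    rw [Matrix.mulVec_mulVec, Matrix.nonsing_inv_mul _ hPu, Matrix.one_mulVec]
  have hsymm : ∀ v w : Fin n → ℝ, v ⬝ᵥ P⁻¹.mulVec w = w ⬝ᵥ P⁻¹.mulVec v := by
    intro v w
    have h1 : P⁻¹.transpose = P⁻¹ := by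
      have := hPd.inv.isHermitian
      rwa [Matrix.IsHermitian, Matrix.conjTranspose_eq_transpose_of_trivial] at this
    rw [Matrix.dotProduct_mulVec, ← Matrix.mulVec_transpose, h1, dotProduct_comm]
  have hmax : ∀ w : EucSp n, α w - N w ^ 2 / 2 ≤ a ⬝ᵥ P.mulVec a / 2 := by
    intro w
    have h1 := F.binetLegendre_self_nonneg x (w - v₀)
    rw [binetLegendre_eq_dotProduct] at h1
    have h2 : (w - v₀ : EucSp n) ⬝ᵥ P⁻¹.mulVec (w - v₀ : EucSp n) =
        w ⬝ᵥ P⁻¹.mulVec w - 2 * (a ⬝ᵥ w) + a ⬝ᵥ P.mulVec a := by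
      rw [WithLp.ofLp_sub, Matrix.mulVec_sub, sub_dotProduct, dotProduct_sub, dotProduct_sub,
        hsymm v₀ w, hGv₀, dotProduct_comm (w : Fin n → ℝ) a, dotProduct_comm (v₀ : Fin n → ℝ) a]
      ring
    rw [h2] at h1
    rw [hα, hN, metricNorm_binetLegendre_sq, binetLegendre_eq_dotProduct]
    linarith
  have hv₀max : α v₀ - N v₀ ^ 2 / 2 = a ⬝ᵥ P.mulVec a / 2 := by
    rw [hα, hN, metricNorm_binetLegendre_sq, binetLegendre_eq_dotProduct, hGv₀,
      dotProduct_comm (v₀ : Fin n → ℝ) a]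
    show a ⬝ᵥ P.mulVec a - a ⬝ᵥ P.mulVec a / 2 = _
    ring
  have hspec := Classical.epsilon_spec (p := fun v : EucSp n => ∀ w : EucSp n,
    α w - N w ^ 2 / 2 ≤ α v - N v ^ 2 / 2) ⟨v₀, fun w => (hmax w).trans hv₀max.ge⟩
  set v : EucSp n := legendre (metricNorm F.binetLegendre) x α with hv
  have hspec' : ∀ w : EucSp n, α w - N w ^ 2 / 2 ≤ α v - N v ^ 2 / 2 := hspec
  have h1 : α v = N v ^ 2 := apply_eq_sq_of_maximizer (F.metricNorm_binetLegendre_smul x) hspec'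
  have h2 : α v - N v ^ 2 / 2 = a ⬝ᵥ P.mulVec a / 2 :=
    le_antisymm (hmax v) (hv₀max.symm.trans_le (hspec' v₀))
  have h3 : a ⬝ᵥ P.mulVec a = F.binetDual x α α := by
    have h4 := (F.isMinkowskiNorm x).dotProduct_momentMatrix_mulVec a
    have h5 : ∀ v : EucSp n, (a ⬝ᵥ v) ^ 2 = α v * α v := fun v => by rw [hα, sq]
    simp_rw [h5] at h4
    exact h4
  have h5 : N v ^ 2 = a ⬝ᵥ P.mulVec a := by linarith
  rw [← h3, ← h5]

theorem apply_le_reversibility_mul (hF : F.reversibility ≠ ⊤) (x : M) (v : EucSp n) :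
    F.toFun x v ≤ F.reversibility.toReal * F.toFun x (-v) := by
  have hN := F.isMinkowskiNorm x
  by_cases hv : v = 0
  · subst hv
    have h0 : F.toFun x (0 : EucSp n) = 0 := hN.map_zero
    have h1 : F.toFun x (-(0 : EucSp n)) = 0 := by rw [neg_zero]; exact h0
    rw [h0]
    exact mul_nonneg ENNReal.toReal_nonneg (F.nonneg x _)
  · have h1 : ENNReal.ofReal (F.toFun x v / F.toFun x (-v)) ≤ F.reversibility :=
      le_iSup_of_le x (le_iSup₂_of_le (f := fun (v : TangentSpace (𝓡 n) x) (_ : v ≠ 0) =>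
        ENNReal.ofReal (F.toFun x v / F.toFun x (-v))) v hv le_rfl)
    have h2 : 0 < F.toFun x (-v) := hN.pos (-v) (neg_ne_zero.2 hv)
    rwa [ENNReal.ofReal_le_iff_le_toReal hF, div_le_iff₀ h2] at h1

theorem one_le_reversibility [Nonempty M] (hn : 1 ≤ n) (hF : F.reversibility ≠ ⊤) :
    1 ≤ F.reversibility.toReal := by
  obtain ⟨x⟩ := ‹Nonempty M›
  set v : EucSp n := EuclideanSpace.single ⟨0, hn⟩ 1 with hv
  have hv0 : v ≠ 0 := by simp [hv]
  have h0 : 0 < F.toFun x v := (F.isMinkowskiNorm x).pos v hv0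
  have h1 := F.apply_le_reversibility_mul hF x v
  have h2 : F.toFun x (-v) ≤ F.reversibility.toReal * F.toFun x v := by
    have := F.apply_le_reversibility_mul hF x (-v)
    rwa [neg_neg] at this
  have h3 : (0 : ℝ) ≤ F.reversibility.toReal := ENNReal.toReal_nonneg
  by_contra! h
  nlinarith [F.nonneg x (-v)]

/-- The constant `(κ_F √(2n))^{n+1}` relating the two dual norms; it is at least
`max (2 √n κ_F) (√(n+2) κ_F)`. -/
noncomputable def gradientConst : ℝ := (F.reversibility.toReal * Real.sqrt (2 * (n : ℝ))) ^ (n + 1)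

theorem gradientConst_nonneg : 0 ≤ F.gradientConst := by
  have : (0 : ℝ) ≤ F.reversibility.toReal := ENNReal.toReal_nonneg
  unfold gradientConst
  positivity

theorem mul_sq_le_gradientConst_sq [Nonempty M] (hn : 1 ≤ n) (hF : F.reversibility ≠ ⊤) :
    4 * (n : ℝ) ^ 2 * F.reversibility.toReal ^ 2 ≤ F.gradientConst ^ 2 := by
  set κ := F.reversibility.toReal with hκ
  have hκ1 : 1 ≤ κ := F.one_le_reversibility hn hF
  have hn' : (1 : ℝ) ≤ n := by exact_mod_cast hn
  have hD : (κ * Real.sqrt (2 * n)) ^ 2 = 2 * n * κ ^ 2 := by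
    rw [mul_pow, Real.sq_sqrt (by positivity)]
    ring
  have hD1 : 1 ≤ 2 * n * κ ^ 2 := by nlinarith [one_le_pow₀ hκ1 (n := 2)]
  calc 4 * (n : ℝ) ^ 2 * κ ^ 2 ≤ 4 * (n : ℝ) ^ 2 * (κ ^ 2 * κ ^ 2) := by
        gcongr
        nlinarith [one_le_pow₀ hκ1 (n := 2)]
    _ = (2 * n * κ ^ 2) ^ 2 := by ring
    _ ≤ (2 * n * κ ^ 2) ^ (n + 1) := pow_le_pow_right₀ hD1 (by omega)
    _ = F.gradientConst ^ 2 := by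
        rw [gradientConst, ← hκ, ← hD, ← pow_mul, ← pow_mul, Nat.mul_comm 2 (n + 1)]

theorem binetDual_self (x : M) (α : EucSp n →L[ℝ] ℝ) :
    F.binetDual x α α = ((n : ℝ) + 2) / volume.real {v : EucSp n | F.toFun x v < 1} *
      ∫ v in {v : EucSp n | F.toFun x v < 1}, α v ^ 2 := by
  simp_rw [sq]
  rfl

theorem binetDual_self_nonneg (x : M) (α : EucSp n →L[ℝ] ℝ) : 0 ≤ F.binetDual x α α := by
  rw [F.binetDual_self]
  exact mul_nonneg (by positivity) (integral_nonneg fun v => sq_nonneg _)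

theorem metricNorm_legendre_le [Nonempty M] (hn : 1 ≤ n) (hF : F.reversibility ≠ ⊤) (x : M)
    (α : TangentSpace (𝓡 n) x →L[ℝ] ℝ) :
    metricNorm F.binetLegendre x (legendre (metricNorm F.binetLegendre) x α) ≤
      F.gradientConst * F.toFun x (legendre F.toFun x α) := by
  have hn' : (1 : ℝ) ≤ n := by exact_mod_cast hn
  refine (sq_le_sq₀ (F.metricNorm_binetLegendre_nonneg _ _)
    (mul_nonneg F.gradientConst_nonneg (F.nonneg _ _))).1 ?_
  refine (F.metricNorm_legendre_sq x α).trans_le ((F.binetDual_self x α).trans_le ?_)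
  refine ((F.isMinkowskiNorm x).moment_le_of_maximizer (F.one_le_reversibility hn hF)
    (F.apply_le_reversibility_mul hF x) (F.legendre_spec x α)).trans ?_
  rw [mul_pow]
  refine mul_le_mul_of_nonneg_right (le_trans ?_ (F.mul_sq_le_gradientConst_sq hn hF))
    (sq_nonneg _)
  gcongr
  nlinarith

theorem legendre_le_metricNorm [Nonempty M] (hn : 1 ≤ n) (hF : F.reversibility ≠ ⊤) (x : M)
    (α : TangentSpace (𝓡 n) x →L[ℝ] ℝ) :
    F.toFun x (legendre F.toFun x α) ≤ F.gradientConst *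
      metricNorm F.binetLegendre x (legendre (metricNorm F.binetLegendre) x α) := by
  have hn' : (1 : ℝ) ≤ n := by exact_mod_cast hn
  refine (sq_le_sq₀ (F.nonneg _ _) (mul_nonneg F.gradientConst_nonneg
    (F.metricNorm_binetLegendre_nonneg _ _))).1 ?_
  refine ((F.isMinkowskiNorm x).sq_le_moment_of_maximizer hn (F.one_le_reversibility hn hF)
    (F.apply_le_reversibility_mul hF x) (F.legendre_spec x α)).trans ?_
  rw [mul_pow]
  refine (mul_le_mul ?_ ((F.binetDual_self x α).symm.trans
    (F.metricNorm_legendre_sq x α).symm).le ?_ (sq_nonneg _))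
  · refine le_trans ?_ (F.mul_sq_le_gradientConst_sq hn hF)
    gcongr
    nlinarith
  · exact (F.binetDual_self x α).symm ▸ F.binetDual_self_nonneg x α

theorem comparisonConst_eq (p k : ℝ) :
    F.comparisonConst p k = F.gradientConst ^ p * (unitBallVol n * k ^ n) := by
  have h0 : 0 ≤ F.reversibility.toReal * Real.sqrt (2 * (n : ℝ)) :=
    mul_nonneg ENNReal.toReal_nonneg (Real.sqrt_nonneg _)
  have h1 : F.gradientConst ^ p =
      (F.reversibility.toReal * Real.sqrt (2 * (n : ℝ))) ^ (p * ((n : ℝ) + 1)) := by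
    rw [gradientConst, ← Real.rpow_natCast, ← Real.rpow_mul h0, mul_comm p]
    push_cast
    rfl
  rw [comparisonConst, h1]
  ring

theorem comparisonConst_pos [Nonempty M] (hn : 1 ≤ n) (hF : F.reversibility ≠ ⊤) (p : ℝ) {k : ℝ}
    (hk : 0 < k) : 0 < F.comparisonConst p k := by
  have h1 : 0 < F.reversibility.toReal := one_pos.trans_le (F.one_le_reversibility hn hF)
  have h2 : (0 : ℝ) < n := by exact_mod_cast hn
  have h3 := unitBallVol_pos n
  unfold comparisonConst
  positivity

variable [MeasurableSpace M] [BorelSpace M]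

/-- Since the Binet–Legendre volume is at most the Busemann–Hausdorff measure, only the upper half
of the volume comparison enters, and its constant enters only once. -/
theorem eigenvalue_comparison [Nonempty M] (hn : 1 ≤ n) (hF : F.reversibility ≠ ⊤)
    (hfin : F.busemannHausdorff univ ≠ ⊤) {k : ℝ} (hk : 0 < k)
    (hle : F.busemannHausdorff ≤
      ENNReal.ofReal (unitBallVol n * k ^ n) • riemannianVol F.binetLegendre)
    {p : ℝ} (hp : 1 < p) :
    F.eigenvalueF p ≤ F.comparisonConst p k * F.eigenvalueBL p ∧
      F.eigenvalueBL p ≤ F.comparisonConst p k * F.eigenvalueF p := by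
  have hω := unitBallVol_pos n
  have hVm : riemannianVol F.binetLegendre ≤ ENNReal.ofReal 1 • F.busemannHausdorff := by
    rw [ENNReal.ofReal_one, one_smul]
    exact F.riemannianVol_binetLegendre_le
  have : IsFiniteMeasure F.busemannHausdorff := ⟨hfin.lt_top⟩
  have : IsFiniteMeasure (riemannianVol F.binetLegendre) :=
    ⟨(F.riemannianVol_binetLegendre_le univ).trans_lt hfin.lt_top⟩
  have hb : 0 < unitBallVol n * k ^ n := by positivity
  rw [comparisonConst_eq]
  constructor
  · have h := firstEigenvalue_le hp one_pos hb F.gradientConst_nonneg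
      F.metricNorm_binetLegendre_nonneg F.nonneg
      (F.legendre_le_metricNorm hn hF) (F.metricNorm_legendre_le hn hF) hVm hle
    rwa [mul_one] at h
  · have h := firstEigenvalue_le hp hb one_pos F.gradientConst_nonneg F.nonneg
      F.metricNorm_binetLegendre_nonneg
      (F.metricNorm_legendre_le hn hF) (F.legendre_le_metricNorm hn hF) hle hVm
    rwa [mul_one] at h

end FinslerMetric
theorem mainTheorem8 (n : ℕ) (hn : 1 ≤ n) :
    ∃ k₀ : ℝ, 0 < k₀ ∧
      ∀ (M : Type*) [TopologicalSpace M] [T2Space M] [SecondCountableTopology M]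
        [ConnectedSpace M] [ChartedSpace (EucSp n) M] [IsManifold (𝓡 n) ∞ M]
        [MeasurableSpace M] [BorelSpace M] (F : FinslerMetric n M),
        F.reversibility ≠ ⊤ →
        F.VolumeComparison k₀ ∧
        (F.busemannHausdorff univ ≠ ⊤ →
          ∀ k : ℝ, 0 < k → F.VolumeComparison k → ∀ p : ℝ, 1 < p →
            (F.comparisonConst p k)⁻¹ * F.eigenvalueBL p ≤ F.eigenvalueF p ∧
            F.eigenvalueF p ≤ F.comparisonConst p k * F.eigenvalueBL p ∧
            (0 < F.eigenvalueBL p →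
              (F.comparisonConst p k)⁻¹ ≤ F.eigenvalueF p / F.eigenvalueBL p ∧
              F.eigenvalueF p / F.eigenvalueBL p ≤ F.comparisonConst p k)) := by
  obtain ⟨k₀, hk₀, h⟩ := FinslerMetric.exists_volumeComparison hn
  refine ⟨k₀, hk₀, fun M _ _ _ _ _ _ _ _ F hF => ⟨h M F, fun hfin k hk hcomp p hp => ?_⟩⟩
  obtain ⟨h1, h2⟩ := F.eigenvalue_comparison hn hF hfin hk hcomp.2 hp
  have hK := F.comparisonConst_pos hn hF p hk
  have h3 : (F.comparisonConst p k)⁻¹ * F.eigenvalueBL p ≤ F.eigenvalueF p :=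
    (inv_mul_le_iff₀ hK).2 h2
  refine ⟨h3, h1, fun hpos => ⟨?_, ?_⟩⟩
  · exact (le_div_iff₀ hpos).2 h3
  · exact (div_le_iff₀ hpos).2 h1
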